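/- Let $d\ge 1$, let $\Gamma_0$ be the set of finite subsets (configurations) of $\mathbb{R}^d$ with its usual Borel $\sigma$-algebra, and let $\lambda=\delta_\emptyset+\sum_{n\ge1}\frac1{n!}m^{(n)}$ be the Lebesgue–Poisson measure on $\Gamma_0$, where $m^{(n)}$ is the image of Lebesgue measure $dx_1\cdots dx_n$ on the $n$-tuples of distinct points under $(x_1,\dots,x_n)\mapsto\{x_1,\dots,x_n\}$. For $f:\mathbb{R}^d\to\mathbb{R}$ and $\eta\in\Gamma_0$ put $e(f,\eta)=\prod_{x\in\eta}f(x)$. For $\alpha\in\mathbb{R}$ let $\mathcal{K}_\alpha$ be the Banach space of ($\lambda$-a.e. classes of) measurable $k:\Gamma_0\to\mathbb{R}$ with $\|k\|_\alpha=\operatorname{ess\,sup}_{\eta}|k(\eta)|e^{\alpha|\eta|}<\infty$. Let $\varkappa>0$ and let $\phi:\mathbb{R}^d\to[0,\infty)$ satisfy $\phi(-x)=\phi(x)$ and $\phi\in L^1(\mathbb{R}^d)\cap L^\infty(\mathbb{R}^d)$; put $\langle\phi\rangle=\int_{\mathbb{R}^d}\phi(x)\,dx$. For an activity $z>0$ and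 a potential $\psi\ge0$ let $$(L^\Delta_{z,\psi}k)(\eta)=-|\eta|k(\eta)+z\sum_{x\in\eta}e(e^{-\psi(x-\cdot)},\eta\setminus x)\int_{\Gamma_0}e(e^{-\psi(x-\cdot)}-1,\xi)\,k((\eta\setminus x)\cup\xi)\,\lambda(d\xi).$$ For $\varepsilon>0$ let $(R_\varepsilon k)(\eta)=\varepsilon^{|\eta|}k(\eta)$ and $L_{\varepsilon,\mathrm{ren}}=R_\varepsilon L^\Delta_{\varepsilon^{-1}\varkappa,\,\varepsilon\phi}R_\varepsilon^{-1}$, and let $$(L_Vk)(\eta)=-|\eta|k(\eta)+\varkappa\sum_{x\in\eta}\int_{\Gamma_0}e(-\phi(x-\cdot),\xi)\,k((\eta\setminus x)\cup\xi)\,\lambda(d\xi).$$ Let $\alpha<\alpha_0$ be real numbers, let $$\widetilde T(\alpha_0,\alpha)=\frac{\alpha_0-\alpha}{1+\varkappa\exp\left(\alpha_0+\langle\phi\rangle e^{-\alpha}\right)},$$ and let $r_0\in\mathcal{K}_{\alpha_0}$. By a classical solution in $\mathcal{K}_\alpha$ on $[0,\widetilde T(\alpha_0,\alpha))$ of $\frac{d}{dt}u_t=Au_t$,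 $u_t|_{t=0}=r_0$, we mean a map $t\mapsto u_t\in\mathcal{K}_\alpha$ that is continuous on $[0,\widetilde T(\alpha_0,\alpha))$ and continuously differentiable on $(0,\widetilde T(\alpha_0,\alpha))$ in the norm of $\mathcal{K}_\alpha$, with $Au_t\in\mathcal{K}_\alpha$ and $\frac{d}{dt}u_t=Au_t$ for $0<t<\widetilde T(\alpha_0,\alpha)$, and with $u_0=r_0$. Then: 1. for every $\varepsilon>0$ the problem $\frac{d}{dt}k^{(\varepsilon)}_{t,\mathrm{ren}}=L_{\varepsilon,\mathrm{ren}}k^{(\varepsilon)}_{t,\mathrm{ren}}$, $k^{(\varepsilon)}_{0,\mathrm{ren}}=r_0$, and likewise the Vlasov hierarchy $\frac{d}{dt}r_t=L_Vr_t$, $r_t|_{t=0}=r_0$, has a unique classical solution in $\mathcal{K}_\alpha$ on $[0,\widetilde T(\alpha_0,\alpha))$; 2. for every $T<\widetilde T(\alpha_0,\alpha)$, $$\lim_{\varepsilon\to0+}\ \sup_{t\in[0,T]}\left\|k^{(\varepsilon)}_{t,\mathrm{ren}}-r_t\right\|_\alpha=0 .$$ -/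

import Mathlib

open MeasureTheory Set Filter Topology

noncomputable section

namespace GlauberVlasov

/-- The one-particle space `ℝ^d`. -/
abbrev Pt (d : ℕ) : Type := EuclideanSpace ℝ (Fin d)

/-- The set `Γ₀` of finite configurations in `ℝ^d`, that is, of finite subsets of `ℝ^d`. It is a
new type because its `σ`-algebra is not the (much smaller) one that `Finset` carries. -/
@[ext]
structure FinConf (d : ℕ) : Type where
  /-- The finite set of the points of the configuration. -/
  points : Finset (Pt d)

namespace FinConf

/-- The number of points `|η|`. -/
def card {d : ℕ} (η : FinConf d) : ℕ := η.points.card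

open Classical in
/-- The configuration `η \ x`. -/
def erase {d : ℕ} (η : FinConf d) (x : Pt d) : FinConf d := ⟨η.points.erase x⟩

open Classical in
/-- The configuration `η ∪ ξ`. -/
def union {d : ℕ} (η ξ : FinConf d) : FinConf d := ⟨η.points ∪ ξ.points⟩

end FinConf

/-- Ordered tuples `(x₁, …, x_n)` of pairwise distinct points of `ℝ^d`, for all `n ≥ 0`. -/
abbrev DistinctTuples (d n : ℕ) : Type := {x : Fin n → Pt d // Function.Injective x}

open Classical in
/-- The symmetrization map `(x₁, …, x_n) ↦ {x₁, …, x_n}`, which identifies `Γ⁽ⁿ⁾` with the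
quotient of the distinct tuples by the permutations of the indices. -/
def toConf {d : ℕ} (n : ℕ) (x : DistinctTuples d n) : FinConf d :=
  ⟨Finset.univ.image x.1⟩

/-- The Borel `σ`-algebra of `Γ₀ = ⨆ₙ Γ⁽ⁿ⁾` (disjoint union): a set `A` is measurable iff, for
each `n`, the set of the tuples `x` of distinct points with `{x₁, …, x_n} ∈ A` is Borel. -/
instance instMeasurableSpaceFinConf (d : ℕ) : MeasurableSpace (FinConf d) :=
  MeasurableSpace.map (fun p : (Σ n : ℕ, DistinctTuples d n) => toConf p.1 p.2) inferInstance

/-- The measure `m⁽ⁿ⁾` on `Γ⁽ⁿ⁾ ⊆ Γ₀`: the image of the Lebesgue measure `dx₁ ⋯ dx_n`, restricted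
to the tuples of distinct points, under symmetrization. For `n = 0` this is the Dirac measure
at the empty configuration. -/
def levelMeasure (d n : ℕ) : Measure (FinConf d) :=
  Measure.map (toConf n)
    (Measure.comap (Subtype.val : DistinctTuples d n → (Fin n → Pt d)) volume)

/-- The Lebesgue–Poisson measure `λ = δ_∅ + ∑_{n ≥ 1} (1 / n!) m⁽ⁿ⁾` on `Γ₀`. -/
def lebesguePoisson (d : ℕ) : Measure (FinConf d) :=
  Measure.sum fun n : ℕ => ((n.factorial : ENNReal)⁻¹) • levelMeasure d n

/-! ### The spaces `K_α` -/

/-- The weight `exp(α |η|)`. -/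
def weight {d : ℕ} (α : ℝ) (η : FinConf d) : ℝ := Real.exp (α * (η.card : ℝ))

/-- The condition that the essential supremum of `|k(η)| exp(α |η|)` is finite. -/
def IsWeightedBounded {d : ℕ} (α : ℝ) (k : FinConf d →ₘ[lebesguePoisson d] ℝ) : Prop :=
  MemLp (fun η => weight α η * k η) ⊤ (lebesguePoisson d)

/-- The elements of `K_α`, as a linear subspace of the space of all classes of measurable
functions `Γ₀ → ℝ` modulo equality `λ`-almost everywhere. -/
def kSubmodule (d : ℕ) (α : ℝ) : Submodule ℝ (FinConf d →ₘ[lebesguePoisson d] ℝ) where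
  carrier := {k | IsWeightedBounded α k}
  zero_mem' := by
    refine (memLp_congr_ae ?_).2 (MemLp.zero (p := ⊤) (μ := lebesguePoisson d) (ε := ℝ))
    filter_upwards [AEEqFun.coeFn_zero (β := ℝ) (μ := lebesguePoisson d)] with η h
    simp [h]
  add_mem' := by
    intro k l hk hl
    refine (memLp_congr_ae ?_).2 (MemLp.add hk hl)
    filter_upwards [AEEqFun.coeFn_add k l] with η h
    simp [h, mul_add]
  smul_mem' := by
    intro c k hk
    refine (memLp_congr_ae ?_).2 (MemLp.const_smul hk c)
    filter_upwards [AEEqFun.coeFn_smul c k] with η h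
    simp [h, mul_left_comm]

/-- The Banach space `K_α`: the classes of measurable `k : Γ₀ → ℝ` with
`‖k‖_α = ess sup |k(η)| exp(α |η|) < ∞` (see `norm_def`). -/
def K (d : ℕ) (α : ℝ) : Type := kSubmodule d α

instance (d : ℕ) (α : ℝ) : AddCommGroup (K d α) :=
  inferInstanceAs (AddCommGroup (kSubmodule d α))

instance (d : ℕ) (α : ℝ) : Module ℝ (K d α) :=
  inferInstanceAs (Module ℝ (kSubmodule d α))

/-- The class of functions underlying an element of `K_α`. -/
def K.toClass {d : ℕ} {α : ℝ} (k : K d α) : FinConf d →ₘ[lebesguePoisson d] ℝ := k.1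

/-- A representative of an element of `K_α`. -/
def K.rep {d : ℕ} {α : ℝ} (k : K d α) : FinConf d → ℝ := k.toClass

theorem K.memLp {d : ℕ} {α : ℝ} (k : K d α) :
    MemLp (fun η => weight α η * k.rep η) ⊤ (lebesguePoisson d) := k.2

/-- Multiplication by the weight, `k ↦ exp(α |·|) k`, from `K_α` to `L^∞(Γ₀, dλ)`. -/
def K.toLinfty (d : ℕ) (α : ℝ) : K d α →ₗ[ℝ] Lp ℝ ⊤ (lebesguePoisson d) where
  toFun k := k.memLp.toLp _
  map_add' k l := by
    rw [← MemLp.toLp_add]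
    refine MemLp.toLp_congr _ _ ?_
    filter_upwards [AEEqFun.coeFn_add k.toClass l.toClass] with η h
    change weight α η * (k.toClass + l.toClass : FinConf d →ₘ[lebesguePoisson d] ℝ) η = _
    rw [h]
    exact mul_add _ _ _
  map_smul' c k := by
    rw [RingHom.id_apply, ← MemLp.toLp_const_smul]
    refine MemLp.toLp_congr _ _ ?_
    filter_upwards [AEEqFun.coeFn_smul c k.toClass] with η h
    change weight α η * (c • k.toClass : FinConf d →ₘ[lebesguePoisson d] ℝ) η = _
    rw [h]
    exact mul_left_comm _ _ _

theorem K.toLinfty_injective (d : ℕ) (α : ℝ) : Function.Injective (K.toLinfty d α) := by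
  intro k l h
  have h' := (MemLp.toLp_eq_toLp_iff k.memLp l.memLp).1 h
  apply Subtype.ext
  apply AEEqFun.ext
  filter_upwards [h'] with η hη
  exact mul_left_cancel₀ (Real.exp_pos _).ne' hη

instance (d : ℕ) (α : ℝ) : NormedAddCommGroup (K d α) :=
  NormedAddCommGroup.induced (K d α) (Lp ℝ ⊤ (lebesguePoisson d)) (K.toLinfty d α)
    (K.toLinfty_injective d α)

instance (d : ℕ) (α : ℝ) : NormedSpace ℝ (K d α) :=
  NormedSpace.induced ℝ (K d α) (Lp ℝ ⊤ (lebesguePoisson d)) (K.toLinfty d α)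

theorem norm_def {d : ℕ} {α : ℝ} (k : K d α) :
    ‖k‖ = (essSup (fun η => ‖k.rep η * Real.exp (α * (η.card : ℝ))‖ₑ)
      (lebesguePoisson d)).toReal := by
  change ‖k.memLp.toLp _‖ = _
  rw [Lp.norm_toLp, eLpNorm_exponent_top, eLpNormEssSup]
  simp only [weight, mul_comm]

/-! ### The generators -/

/-- The Lebesgue–Poisson exponent `e(f, η) = ∏_{x ∈ η} f(x)`. -/
def lpExp {d : ℕ} (f : Pt d → ℝ) (η : FinConf d) : ℝ := ∏ x ∈ η.points, f x

/-- `τ_x(y) = exp(-φ(x - y))`. -/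
def tau {d : ℕ} (φ : Pt d → ℝ) (x y : Pt d) : ℝ := Real.exp (-φ (x - y))

/-- The operator `L^Δ` of the Glauber dynamics with activity `ϰ` and potential `φ`,
`(L^Δ k)(η) = -|η| k(η)
  + ϰ ∑_{x ∈ η} e(τ_x, η \ x) ∫_{Γ₀} e(τ_x - 1, ξ) k((η \ x) ∪ ξ) λ(dξ)`. -/
def LDelta {d : ℕ} (ϰ : ℝ) (φ : Pt d → ℝ) (k : FinConf d → ℝ) (η : FinConf d) : ℝ :=
  -(η.card : ℝ) * k η + ϰ * ∑ x ∈ η.points, lpExp (tau φ x) (η.erase x) *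
    ∫ ξ, lpExp (fun y => tau φ x y - 1) ξ * k ((η.erase x).union ξ) ∂(lebesguePoisson d)

/-- The rescaling `(R_ε k)(η) = ε^{|η|} k(η)`. -/
def rescale {d : ℕ} (ε : ℝ) (k : FinConf d → ℝ) (η : FinConf d) : ℝ := ε ^ η.card * k η

/-- The operator `L_{ε,ren} = R_ε L^Δ_ε R_ε⁻¹` governing the rescaled correlation functions, where
`L^Δ_ε` is `L^Δ` with `ε φ` and `ε⁻¹ ϰ` in place of `φ` and `ϰ`. -/
def LRen {d : ℕ} (ϰ : ℝ) (φ : Pt d → ℝ) (ε : ℝ) (k : FinConf d → ℝ) : FinConf d → ℝ :=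
  rescale ε (LDelta (ε⁻¹ * ϰ) (fun x => ε * φ x) (rescale ε⁻¹ k))

/-- The operator of the Vlasov hierarchy,
`(L_V k)(η) = -|η| k(η) + ϰ ∑_{x ∈ η} ∫_{Γ₀} e(-φ(x - ·), ξ) k((η \ x) ∪ ξ) λ(dξ)`. -/
def LVlasov {d : ℕ} (ϰ : ℝ) (φ : Pt d → ℝ) (k : FinConf d → ℝ) (η : FinConf d) : ℝ :=
  -(η.card : ℝ) * k η + ϰ * ∑ x ∈ η.points,
    ∫ ξ, lpExp (fun y => -φ (x - y)) ξ * k ((η.erase x).union ξ) ∂(lebesguePoisson d)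

/-! ### Cauchy problems -/

/-- `u` is a classical solution in `K_α`, on the time interval `[0, T)`, of the Cauchy problem
`du/dt = A u`, `u|_{t=0} = u₀`: it is norm-continuous on `[0, T)`, norm-continuously
differentiable on `(0, T)`, for each `t ∈ (0, T)` the function `A u(t)` belongs to `K_α` and
equals the derivative of `u` at `t`, and `u(0) = u₀`. Only the values of `u` on `[0, T)` matter. -/
structure IsClassicalSolution {d : ℕ} {α : ℝ} (A : (FinConf d → ℝ) → FinConf d → ℝ)
    (u₀ : FinConf d →ₘ[lebesguePoisson d] ℝ) (T : ℝ) (u : ℝ → K d α) : Prop where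
  continuousOn : ContinuousOn u (Ico 0 T)
  differentiableOn : DifferentiableOn ℝ u (Ioo 0 T)
  continuousOn_deriv : ContinuousOn (deriv u) (Ioo 0 T)
  equation : ∀ t ∈ Ioo 0 T, (deriv u t).rep =ᵐ[lebesguePoisson d] A (u t).rep
  initial : (u 0).toClass = u₀

/-- `T̃(α₀, α) = (α₀ - α) / (1 + ϰ exp(α₀ + ⟨φ⟩ e^{-α}))`, where `⟨φ⟩ = ∫ φ(x) dx`. -/
def timeBound {d : ℕ} (ϰ : ℝ) (φ : Pt d → ℝ) (α₀ α : ℝ) : ℝ :=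
  (α₀ - α) / (1 + ϰ * Real.exp (α₀ + (∫ x, φ x) * Real.exp (-α)))

end GlauberVlasov

end

/-! Since $|(\eta\setminus x)\cup\xi|=|\eta|-1+|\xi|$ for almost every $\xi$, conjugation by
$R_\varepsilon$ only changes the kernels. Both generators are a `glauberOp` with a pair $(C,G)$:
$(e^{-\varepsilon\phi},\varepsilon^{-1}(e^{-\varepsilon\phi}-1))$ for the rescaled dynamics and
$(1,-\phi)$ for the Vlasov hierarchy. In both cases $0\le C\le1$ and $|G|\le\phi$, so every estimate
is uniform in $\varepsilon$.

The identity $\int e(f,\xi)\,\lambda(d\xi)=\exp\int f$ gives $|Ak(\eta)|\le|\eta|(1+\varkappa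
e^{a+\langle\phi\rangle e^{-a}})\|k\|_ae^{-a|\eta|}$. The unbounded factor $|\eta|$ is paid for by
lowering the index: $A$ maps $\mathcal K_a$ to $\mathcal K_b$ with norm at most $M/(e(a-b))$ for
$\alpha\le b<a\le\alpha_0$, where $M$ is the denominator of $\widetilde T$ (`IsKernel.isSingular`).

The rest is Ovsyannikov's method. Descending from $\alpha_0$ to $\alpha$ in $n$ equal steps gives
$\|A^nr_0\|_\alpha\le n!\,(M/(\alpha_0-\alpha))^n\|r_0\|$ (`IsSingular.exists_iterate`), so $\sum
t^nA^nr_0/n!$ converges for $|t|<\widetilde T$ and solves the problem on $[0,\widetilde T)$.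
Uniqueness (`IsSolution.eqOn`) views the difference of two solutions in the larger spaces below
$\mathcal K_\alpha$ and integrates the equation $n$ times while descending $n$ steps.

For the limit, the kernels differ by $O(\varepsilon)$, so the generators converge strongly from each
$\mathcal K_a$ to each $\mathcal K_b$ with $b<a$. Hence so do the series coefficients
(`tendsto_iterate`), and a geometric majorant independent of $\varepsilon$ allows the limit to pass
through the series, uniformly on $[0,T]$. -/

noncomputable section

namespace GlauberVlasov

/-! ### Linear evolution equations in scales of Banach spaces -/

/-! ### Exponential generating series in normed spaces -/

section ExpSeries

variable {F : Type*} [NormedAddCommGroup F] [NormedSpace ℝ F]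

/-- The exponential generating series `∑ₙ tⁿ / n! • a n`. -/
def expSeries (a : ℕ → F) (t : ℝ) : F := ∑' n : ℕ, (t ^ n / (n.factorial : ℝ)) • a n

/-- The exponential generating series of `a` converges absolutely for `|t| < R`. -/
def ExpSummable (a : ℕ → F) (R : ℝ) : Prop :=
  ∀ s, 0 < s → s < R → Summable fun n : ℕ => s ^ n / (n.factorial : ℝ) * ‖a n‖

theorem expSeries_zero (a : ℕ → F) : expSeries a 0 = a 0 := by
  rw [expSeries, tsum_eq_single 0 fun n hn => by simp [hn]]
  simp

theorem ExpSummable.of_le {F : Type*} [NormedAddCommGroup F] {a : ℕ → F} {q c : ℝ} (hq : 0 < q)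
    (ha : ∀ n, ‖a n‖ ≤ (n.factorial : ℝ) * q ^ n * c) : ExpSummable a q⁻¹ := by
  intro s hs hsq
  have h1 : s * q < 1 := by
    rwa [lt_inv_comm₀ hs hq, lt_inv_comm₀ hq hs, ← one_div, lt_div_iff₀ hq] at hsq
  refine Summable.of_nonneg_of_le (fun n => by positivity) (fun n => ?_)
    ((summable_geometric_of_lt_one (by positivity) h1).mul_right c)
  calc s ^ n / (n.factorial : ℝ) * ‖a n‖
      ≤ s ^ n / (n.factorial : ℝ) * ((n.factorial : ℝ) * q ^ n * c) := by
        gcongr; exact ha n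
    _ = (s * q) ^ n * c := by
        have : (n.factorial : ℝ) ≠ 0 := by positivity
        rw [mul_pow]
        field_simp

/-- The shift costs a factor $n+1$, which is absorbed by $(s/s')^n$ for a slightly larger radius
$s'<R$. -/
theorem ExpSummable.succ {F : Type*} [NormedAddCommGroup F] {a : ℕ → F} {R : ℝ} (h : ExpSummable a R) :
    ExpSummable (fun n => a (n + 1)) R := by
  intro s hs hsR
  obtain ⟨s', h1, h2⟩ := exists_between hsR
  have hs' : 0 < s' := hs.trans h1
  obtain ⟨D, hD⟩ : ∃ D, ∀ n : ℕ, s' ^ n / (n.factorial : ℝ) * ‖a n‖ ≤ D := by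
    obtain ⟨D, hD⟩ := (h s' hs' h2).tendsto_atTop_zero.bddAbove_range
    exact ⟨D, fun n => hD ⟨n, rfl⟩⟩
  have hr : ‖s / s'‖ < 1 := by
    rw [Real.norm_of_nonneg (by positivity), div_lt_one hs']; exact h1
  have hsum : Summable fun n : ℕ => (((n : ℝ) ^ 1 * (s / s') ^ n) + (s / s') ^ n) * (D / s') :=
    ((summable_pow_mul_geometric_of_norm_lt_one 1 hr).add
      (summable_geometric_of_norm_lt_one hr)).mul_right _
  refine Summable.of_nonneg_of_le (fun n => by positivity) (fun n => ?_) hsum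
  have e : s ^ n / (n.factorial : ℝ) * ‖a (n + 1)‖ =
      ((n : ℝ) + 1) * (s / s') ^ n / s' *
        (s' ^ (n + 1) / ((n + 1).factorial : ℝ) * ‖a (n + 1)‖) := by
    have : (n.factorial : ℝ) ≠ 0 := by positivity
    rw [Nat.factorial_succ, div_pow, pow_succ s']
    push_cast
    field_simp
  rw [e]
  calc _ ≤ ((n : ℝ) + 1) * (s / s') ^ n / s' * D := by
        gcongr; exact hD (n + 1)
    _ = _ := by ring

variable [CompleteSpace F]

theorem ExpSummable.summable {a : ℕ → F} {R t : ℝ} (h : ExpSummable a R) (ht : |t| < R) :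
    Summable fun n : ℕ => (t ^ n / (n.factorial : ℝ)) • a n := by
  obtain ⟨s, h1, h2⟩ := exists_between ht
  refine Summable.of_norm_bounded (h s ((abs_nonneg t).trans_lt h1) h2) fun n => ?_
  rw [norm_smul, norm_div, norm_pow, Real.norm_eq_abs, Real.norm_natCast]
  gcongr

theorem ExpSummable.hasDerivAt {a : ℕ → F} {R t : ℝ} (h : ExpSummable a R) (ht : |t| < R) :
    HasDerivAt (expSeries a) (expSeries (fun n => a (n + 1)) t) t := by
  obtain ⟨s, h1, h2⟩ := exists_between ht
  have hs : 0 < s := (abs_nonneg t).trans_lt h1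
  have hterm : ∀ (n : ℕ) (y : ℝ), HasDerivAt (fun y : ℝ => (y ^ (n + 1) / ((n + 1).factorial : ℝ))
      • a (n + 1)) ((y ^ n / (n.factorial : ℝ)) • a (n + 1)) y := by
    intro n y
    have := ((hasDerivAt_pow (n + 1) y).div_const ((n + 1).factorial : ℝ)).smul_const (a (n + 1))
    convert this using 2
    have : (n.factorial : ℝ) ≠ 0 := by positivity
    rw [Nat.factorial_succ]
    push_cast
    field_simp
  have key := hasDerivAt_tsum_of_isPreconnected (𝕜 := ℝ) (t := Ioo (-s) s) (y₀ := t) (y := t)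
    (h.succ s hs h2) isOpen_Ioo isPreconnected_Ioo (fun n y _ => hterm n y) (fun n y hy => by
      rw [norm_smul, norm_div, norm_pow, Real.norm_eq_abs, Real.norm_natCast]
      gcongr
      exact (abs_lt.2 hy).le) (abs_lt.1 h1)
      ((summable_nat_add_iff 1).2 (h.summable ht)) (abs_lt.1 h1)
  -- Splitting off the constant term leaves only powers $y^{n+1}$, whose derivatives are exactly the
  -- terms of the shifted series.
  have heq : expSeries a =ᶠ[𝓝 t] fun y => a 0 +
      ∑' n : ℕ, (y ^ (n + 1) / ((n + 1).factorial : ℝ)) • a (n + 1) := by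
    filter_upwards [(isOpen_Ioo (a := -R) (b := R)).mem_nhds (abs_lt.1 ht)] with y hy
    rw [expSeries, (h.summable (abs_lt.2 hy)).tsum_eq_zero_add]
    simp
  exact (key.const_add (a 0)).congr_of_eventuallyEq heq

end ExpSeries

/-- A scale of normed spaces `E a`, decreasing in `a`, inside a common vector space `V`. -/
structure NormedScale (E : ℝ → Type*) [∀ a, NormedAddCommGroup (E a)] [∀ a, NormedSpace ℝ (E a)]
    (V : Type*) [AddCommGroup V] [Module ℝ V] where
  /-- The inclusion into the common vector space. -/
  toV : ∀ a, E a →ₗ[ℝ] V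
  toV_injective : ∀ a, Function.Injective (toV a)
  /-- The inclusions of the scale. -/
  incl : ∀ {a b : ℝ}, b ≤ a → E a →L[ℝ] E b
  toV_incl : ∀ {a b : ℝ} (h : b ≤ a) (x : E a), toV b (incl h x) = toV a x
  norm_incl_le : ∀ {a b : ℝ} (h : b ≤ a) (x : E a), ‖incl h x‖ ≤ ‖x‖

/-! ### Iterates of singular operators on a scale -/

namespace NormedScale

variable {E : ℝ → Type*} [∀ a, NormedAddCommGroup (E a)] [∀ a, NormedSpace ℝ (E a)]
  {V : Type*} [AddCommGroup V] [Module ℝ V] (S : NormedScale E V)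

/-- The map `A` acts from `E a` to `E b` with norm at most `M / (e (a - b))`, for all
`lo ≤ b < a ≤ hi`. -/
def IsSingular (A : V → V) (M lo hi : ℝ) : Prop :=
  ∀ a b, lo ≤ b → b < a → a ≤ hi → ∃ L : E a →L[ℝ] E b,
    (∀ x, S.toV b (L x) = A (S.toV a x)) ∧ ∀ x, ‖L x‖ ≤ M / (Real.exp 1 * (a - b)) * ‖x‖

/-- Classical solutions in `E α` on `[0, T)` of `du/dt = A u`, `u|_{t=0} = v`. -/
structure IsSolution (A : V → V) (v : V) (T : ℝ) {α : ℝ} (u : ℝ → E α) : Prop where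
  continuousOn : ContinuousOn u (Ico 0 T)
  differentiableOn : DifferentiableOn ℝ u (Ioo 0 T)
  continuousOn_deriv : ContinuousOn (deriv u) (Ioo 0 T)
  equation : ∀ t ∈ Ioo 0 T, S.toV α (deriv u t) = A (S.toV α (u t))
  initial : S.toV α (u 0) = v

variable {S} {A : V → V} {M lo hi : ℝ}

/-- With $n$ equal steps of length $(hi-b)/n$, each application costs $Mn/(e(hi-b))$; the product is
controlled by $n^n\le n!\,e^n$. -/
theorem IsSingular.exists_iterate (h : S.IsSingular A M lo hi) (hM : 0 < M) (r : E hi) {b : ℝ}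
    (hlo : lo ≤ b) (hb : b < hi) (n : ℕ) :
    ∃ x : E b, S.toV b x = A^[n] (S.toV hi r) ∧
      ‖x‖ ≤ (n.factorial : ℝ) * (M / (hi - b)) ^ n * ‖r‖ := by
  have hb' : 0 < hi - b := sub_pos.2 hb
  rcases Nat.eq_zero_or_pos n with rfl | hn
  · exact ⟨S.incl hb.le r, S.toV_incl _ _, by simpa using S.norm_incl_le hb.le r⟩
  have hn' : (0 : ℝ) < n := by exact_mod_cast hn
  set δ := (hi - b) / n with hδ
  have hδ0 : 0 < δ := by positivity
  have hnδ : n * δ = hi - b := by rw [hδ]; field_simp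
  -- The index `c` is a variable tied by an equation, which avoids transport between the types `E
  -- c`.
  have step : ∀ i : ℕ, i ≤ n → ∀ c, c = hi - i * δ → ∃ x : E c,
      S.toV c x = A^[i] (S.toV hi r) ∧ ‖x‖ ≤ (M / (Real.exp 1 * δ)) ^ i * ‖r‖ := by
    intro i
    induction i with
    | zero =>
      rintro - c hc
      obtain rfl : c = hi := by simpa using hc
      exact ⟨r, by simp, by simp⟩
    | succ i ih =>
      intro hi' c hc
      obtain ⟨x, hx, hxn⟩ := ih (by omega) _ rfl
      have hcd : hi - i * δ - c = δ := by rw [hc]; push_cast; ring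
      have hle : ((i + 1 : ℕ) : ℝ) * δ ≤ n * δ := by gcongr
      obtain ⟨L, hL, hLn⟩ := h (hi - i * δ) c (by rw [hc]; linarith) (by linarith)
        (by have : 0 ≤ i * δ := by positivity
            linarith)
      refine ⟨L x, by rw [hL, hx, Function.iterate_succ_apply'], (hLn x).trans ?_⟩
      rw [hcd, pow_succ', mul_assoc]
      gcongr
  obtain ⟨x, hx, hxn⟩ := step n le_rfl b (by rw [hnδ]; ring)
  refine ⟨x, hx, hxn.trans ?_⟩
  gcongr
  have e1 : (M / (Real.exp 1 * δ)) ^ n = (M / (hi - b)) ^ n * (n ^ n / Real.exp n) := by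
    rw [← Real.exp_one_pow n, ← div_pow, ← mul_pow, hδ]
    congr 1
    field_simp
  rw [e1, mul_comm]
  gcongr
  have := Real.pow_div_factorial_le_exp n hn'.le n
  rw [div_le_iff₀ (by positivity)] at this ⊢
  linarith

/-- `A` is a bare map on `V`; its linearity on the image of `E hi` comes from the bounded operator
that realizes it. -/
theorem IsSingular.map_sub (h : S.IsSingular A M lo hi) (hlo : lo < hi) (x y : E hi) :
    A (S.toV hi (x - y)) = A (S.toV hi x) - A (S.toV hi y) := by
  obtain ⟨L, hL, -⟩ := h hi lo le_rfl hlo le_rfl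
  rw [← hL, ← hL, ← hL, _root_.map_sub L, _root_.map_sub]

theorem IsSingular.exists_coeff (h : S.IsSingular A M lo hi) (hM : 0 < M) (hlh : lo < hi)
    (r : E hi) : ∃ a : ℕ → E lo, (∀ n, S.toV lo (a n) = A^[n] (S.toV hi r)) ∧
      ∀ n, ‖a n‖ ≤ (n.factorial : ℝ) * (M / (hi - lo)) ^ n * ‖r‖ := by
  choose a ha using fun n => h.exists_iterate hM r le_rfl hlh n
  exact ⟨a, fun n => (ha n).1, fun n => (ha n).2⟩

/-! ### Existence: the exponential series solves the equation -/

section Existence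

variable [∀ a, CompleteSpace (E a)]

/-- `A` is not bounded on `E lo`, so it cannot be applied termwise there. At a fixed time the series
already converges in a smaller space `E b`, from which `A` is bounded into `E lo`. -/
theorem IsSingular.isSolution_expSeries (h : S.IsSingular A M lo hi) (hM : 0 < M) (hlh : lo < hi)
    (r : E hi) (a : ℕ → E lo) (ha : ∀ n, S.toV lo (a n) = A^[n] (S.toV hi r)) :
    S.IsSolution A (S.toV hi r) ((hi - lo) / M) (expSeries a) := by
  have hsum : ∀ {b : ℝ}, lo ≤ b → b < hi → ∀ c : ℕ → E b,
      (∀ n, S.toV b (c n) = A^[n] (S.toV hi r)) → ExpSummable c ((hi - b) / M) := by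
    intro b hb1 hb2 c hc
    have hb' : 0 < hi - b := sub_pos.2 hb2
    rw [← inv_div]
    refine ExpSummable.of_le (c := ‖r‖) (by positivity) fun n => ?_
    obtain ⟨x, hx, hxn⟩ := h.exists_iterate hM r hb1 hb2 n
    rwa [S.toV_injective b ((hc n).trans hx.symm)]
  have hs := hsum le_rfl hlh a ha
  have habs : ∀ t ∈ Ico 0 ((hi - lo) / M), |t| < (hi - lo) / M := fun t ht => by
    rw [abs_of_nonneg ht.1]; exact ht.2
  have hder : ∀ t ∈ Ioo 0 ((hi - lo) / M), deriv (expSeries a) t =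
      expSeries (fun n => a (n + 1)) t := fun t ht =>
    (hs.hasDerivAt (habs t ⟨ht.1.le, ht.2⟩)).deriv
  refine ⟨fun t ht => (hs.hasDerivAt (habs t ht)).continuousAt.continuousWithinAt,
    fun t ht => (hs.hasDerivAt (habs t ⟨ht.1.le, ht.2⟩)).differentiableAt.differentiableWithinAt,
    ?_, ?_, ?_⟩
  · refine ContinuousOn.congr (fun t ht => ?_) hder
    exact (hs.succ.hasDerivAt (habs t ⟨ht.1.le, ht.2⟩)).continuousAt.continuousWithinAt
  · intro t ht
    rw [hder t ht]
    -- The condition `b < hi - M * t` says that `t` is below the radius $(hi-b)/M$ of convergence in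
    -- `E b`.
    obtain ⟨b, hb1, hb2⟩ : ∃ b, lo < b ∧ b < hi - M * t := by
      refine exists_between ?_
      have := (lt_div_iff₀ hM).1 ht.2
      linarith
    have hb3 : b < hi := by nlinarith [ht.1]
    choose c hc _ using fun n => h.exists_iterate hM r hb1.le hb3 n
    obtain ⟨L, hL, -⟩ := h b lo le_rfl hb1 hb3.le
    have hsc : Summable fun n : ℕ => (t ^ n / (n.factorial : ℝ)) • c n :=
      (hsum hb1.le hb3 c hc).summable (by
        rw [abs_of_pos ht.1, lt_div_iff₀ hM]; linarith)
    have e1 : S.incl hb1.le (expSeries c t) = expSeries a t := by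
      rw [expSeries, ContinuousLinearMap.map_tsum _ hsc]
      refine tsum_congr fun n => ?_
      rw [map_smul]
      congr 1
      exact S.toV_injective lo (by rw [S.toV_incl, hc, ha])
    have e2 : L (expSeries c t) = expSeries (fun n => a (n + 1)) t := by
      rw [expSeries, ContinuousLinearMap.map_tsum _ hsc]
      refine tsum_congr fun n => ?_
      rw [map_smul]
      congr 1
      exact S.toV_injective lo (by rw [hL, hc, ha, Function.iterate_succ_apply'])
    rw [← e1, S.toV_incl, ← hL, e2]
  · rw [expSeries_zero, ha]; rfl

end Existence

/-! ### Uniqueness of classical solutions -/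

section Uniqueness

theorem norm_le_pow_div_factorial_of_norm_deriv_le {F : Type*} [NormedAddCommGroup F]
    [NormedSpace ℝ F] {f f' : ℝ → F} {a b D : ℝ} (hD : 0 ≤ D) {i : ℕ}
    (hf : ContinuousOn f (Icc a b)) (hf' : ∀ t ∈ Ioo a b, HasDerivAt f (f' t) t)
    (hb : ∀ t ∈ Ioo a b, ‖f' t‖ ≤ D * ((t - a) ^ i / (i.factorial : ℝ))) (ha : f a = 0) :
    ∀ t ∈ Icc a b, ‖f t‖ ≤ D * ((t - a) ^ (i + 1) / ((i + 1).factorial : ℝ)) := by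
  intro t ht
  rcases ht.1.eq_or_lt with rfl | hat
  · simp [ha]
  -- The derivative is available only on the open interval, so the mean value inequality is applied
  -- from `s > a`, and then `s` tends to `a`.
  have key : ∀ s ∈ Ioo a t, ‖f t‖ ≤ ‖f s‖ + D * ((t - a) ^ (i + 1) / ((i + 1).factorial : ℝ)) := by
    intro s hs
    refine image_norm_le_of_norm_deriv_right_le_deriv_boundary (f := f) (f' := f') (a := s) (b := t)
      (B := fun x => ‖f s‖ + D * ((x - a) ^ (i + 1) / ((i + 1).factorial : ℝ)))
      (B' := fun x => D * ((x - a) ^ i / (i.factorial : ℝ)))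
      (hf.mono (Icc_subset_Icc hs.1.le ht.2))
      (fun x hx => (hf' x ⟨hs.1.trans_le hx.1, hx.2.trans_le ht.2⟩).hasDerivWithinAt) ?_
      (fun x => ?_) (fun x hx => hb x ⟨hs.1.trans_le hx.1, hx.2.trans_le ht.2⟩)
      (right_mem_Icc.2 hs.2.le)
    · have : 0 ≤ s - a := by linarith [hs.1]
      have : 0 ≤ D * ((s - a) ^ (i + 1) / ((i + 1).factorial : ℝ)) := by positivity
      linarith
    · have := (((((hasDerivAt_id x).sub_const a).pow (i + 1)).div_const
        ((i + 1).factorial : ℝ)).const_mul D).const_add ‖f s‖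
      refine this.congr_deriv ?_
      have : (i.factorial : ℝ) ≠ 0 := by positivity
      rw [Nat.factorial_succ]
      push_cast
      simp only [id_eq]
      field_simp
  have hlim : Tendsto (fun s => ‖f s‖ + D * ((t - a) ^ (i + 1) / ((i + 1).factorial : ℝ)))
      (𝓝[Ioo a t] a) (𝓝 (‖f a‖ + D * ((t - a) ^ (i + 1) / ((i + 1).factorial : ℝ)))) :=
    (((hf a ⟨le_rfl, ht.1.trans ht.2⟩).mono
      (Ioo_subset_Icc_self.trans (Icc_subset_Icc_right ht.2))).norm).add_const _
  have : (𝓝[Ioo a t] a).NeBot := left_nhdsWithin_Ioo_neBot hat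
  have := ge_of_tendsto hlim (eventually_nhdsWithin_of_forall key)
  simpa [ha] using this

/-- Here the solution lives in the top space `E hi` and is estimated in the larger spaces below it.
After $n$ integrations along $n$ steps of the scale, its norm in `E lo` is at most $Dq^n$, with
$q<1$ on a short time interval; injectivity of the inclusion brings the vanishing back to `E hi`. -/
theorem IsSingular.eq_zero_of_hasDerivAt (h : S.IsSingular A M lo hi) (hM : 0 < M) (hlh : lo < hi)
    {T : ℝ} {w w' : ℝ → E hi} (hw : ContinuousOn w (Ico 0 T))
    (hw' : ∀ t ∈ Ioo 0 T, HasDerivAt w (w' t) t)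
    (heq : ∀ t ∈ Ioo 0 T, S.toV hi (w' t) = A (S.toV hi (w t))) (h0 : w 0 = 0) :
    ∀ t ∈ Ico 0 T, w t = 0 := by
  have hlh' : 0 < hi - lo := sub_pos.2 hlh
  -- a solution vanishing at `t₀` vanishes for a further time step of fixed length
  have local_zero : ∀ t₀ T₁ : ℝ, 0 ≤ t₀ → T₁ < T → w t₀ = 0 → ∀ t ∈ Icc t₀ T₁,
      t - t₀ < (hi - lo) / M → w t = 0 := by
    intro t₀ T₁ ht₀ hT₁ hwt₀ t ht htδ
    have hsub : Icc t₀ T₁ ⊆ Ico 0 T := fun s hs => ⟨ht₀.trans hs.1, hs.2.trans_lt hT₁⟩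
    have hsub' : Ioo t₀ T₁ ⊆ Ioo 0 T := fun s hs => ⟨ht₀.trans_lt hs.1, hs.2.trans hT₁⟩
    obtain ⟨D, hD⟩ := isCompact_Icc.exists_bound_of_continuousOn (hw.mono hsub)
    have hD0 : 0 ≤ D := (norm_nonneg _).trans (hD t ht)
    have step : ∀ n : ℕ, 0 < n → ∀ i : ℕ, i ≤ n → ∀ c (hc : c ≤ hi),
        c = hi - i * ((hi - lo) / n) → ∀ s ∈ Icc t₀ T₁, ‖S.incl hc (w s)‖ ≤
          D * (M / (Real.exp 1 * ((hi - lo) / n))) ^ i * ((s - t₀) ^ i / (i.factorial : ℝ)) := by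
      intro n hn i
      have hn' : (0 : ℝ) < n := by exact_mod_cast hn
      set δ := (hi - lo) / n with hδ
      have hδ0 : 0 < δ := by positivity
      have hnδ : n * δ = hi - lo := by rw [hδ]; field_simp
      induction i with
      | zero =>
        intro _ c hc _ s hs
        simpa using (S.norm_incl_le hc (w s)).trans (hD s hs)
      | succ i ih =>
        intro hin c hc hceq
        have hcd : hi - i * δ - c = δ := by rw [hceq]; push_cast; ring
        have hle : ((i + 1 : ℕ) : ℝ) * δ ≤ n * δ := by gcongr
        have hc' : hi - i * δ ≤ hi := by
          have : 0 ≤ i * δ := by positivity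
          linarith
        obtain ⟨L, hL, hLn⟩ := h (hi - i * δ) c (by rw [hceq]; linarith) (by linarith) hc'
        have hLw : ∀ s ∈ Ioo t₀ T₁, S.incl hc (w' s) = L (S.incl hc' (w s)) := fun s hs =>
          S.toV_injective c (by rw [S.toV_incl, heq s (hsub' hs), hL, S.toV_incl])
        refine norm_le_pow_div_factorial_of_norm_deriv_le (f := fun s => S.incl hc (w s))
          (f' := fun s => S.incl hc (w' s)) (by positivity)
          ((S.incl hc).continuous.comp_continuousOn (hw.mono hsub))
          (fun s hs => (S.incl hc).hasFDerivAt.comp_hasDerivAt s (hw' s (hsub' hs)))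
          (fun s hs => ?_) (by simp [hwt₀])
        rw [hLw s hs]
        refine (hLn _).trans ?_
        rw [hcd]
        calc _ ≤ M / (Real.exp 1 * δ) * (D * (M / (Real.exp 1 * δ)) ^ i *
              ((s - t₀) ^ i / (i.factorial : ℝ))) := by
              gcongr
              exact ih (by omega) _ hc' rfl s (Ioo_subset_Icc_self hs)
          _ = _ := by ring
    set q := M / (hi - lo) * (t - t₀) with hq
    have hq0 : 0 ≤ q := mul_nonneg (by positivity) (sub_nonneg.2 ht.1)
    have hq1 : q < 1 := by
      rw [hq, ← div_lt_div_iff_of_pos_right (c := M / (hi - lo)) (by positivity)]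
      simpa [hM.ne', hlh'.ne'] using htδ
    have hbound : ∀ n : ℕ, 0 < n → ‖S.incl hlh.le (w t)‖ ≤ D * q ^ n := by
      intro n hn
      have hn' : (0 : ℝ) < n := by exact_mod_cast hn
      refine (step n hn n le_rfl lo hlh.le (by field_simp; ring) t ht).trans ?_
      have e1 : D * (M / (Real.exp 1 * ((hi - lo) / n))) ^ n *
          ((t - t₀) ^ n / (n.factorial : ℝ)) =
          -- The factor $n^n$ from the $n$ step lengths is cancelled by the $n!$ of the iterated
          -- integral and by $e^n$.
          D * q ^ n * (n ^ n / (n.factorial : ℝ) / Real.exp n) := by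
        rw [← Real.exp_one_pow n, hq]
        simp only [div_pow, mul_pow]
        field_simp
      rw [e1]
      refine mul_le_of_le_one_right (by positivity) ?_
      rw [div_le_one (by positivity)]
      exact Real.pow_div_factorial_le_exp n hn'.le n
    have hlim : Tendsto (fun n : ℕ => D * q ^ n) atTop (𝓝 (D * 0)) :=
      (tendsto_pow_atTop_nhds_zero_of_lt_one hq0 hq1).const_mul D
    have hle := ge_of_tendsto hlim ((eventually_gt_atTop 0).mono hbound)
    rw [mul_zero] at hle
    have hz : S.incl hlh.le (w t) = 0 := norm_le_zero_iff.1 hle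
    refine S.toV_injective hi ?_
    rw [← S.toV_incl hlh.le, hz, map_zero, map_zero]
  -- Half of the admissible length, since `local_zero` requires a strict inequality.
  set δ := (hi - lo) / M / 2 with hδ
  have hδ0 : 0 < δ := by positivity
  have steps : ∀ n : ℕ, ∀ t ∈ Ico 0 T, t ≤ n * δ → w t = 0 := by
    intro n
    induction n with
    | zero =>
      intro t ht htn
      obtain rfl : t = 0 := le_antisymm (by simpa using htn) ht.1
      exact h0
    | succ n ih =>
      intro t ht htn
      push_cast at htn
      rcases le_total t (n * δ) with hle | hle
      · exact ih t ht hle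
      · refine local_zero (n * δ) t (by positivity) ht.2
          (ih _ ⟨by positivity, hle.trans_lt ht.2⟩ le_rfl) t ⟨hle, le_rfl⟩ ?_
        have : (hi - lo) / M = 2 * δ := by rw [hδ]; ring
        linarith
  intro t ht
  obtain ⟨n, hn⟩ := exists_nat_ge (t / δ)
  exact steps n t ht ((div_le_iff₀ hδ0).1 hn)

theorem IsSolution.eqOn (h : S.IsSingular A M lo hi) (hM : 0 < M) (hlh : lo < hi) {T : ℝ} {v : V}
    {u u' : ℝ → E hi} (hu : S.IsSolution A v T u) (hu' : S.IsSolution A v T u') :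
    EqOn u u' (Ico 0 T) := by
  have hd : ∀ {u : ℝ → E hi}, S.IsSolution A v T u → ∀ t ∈ Ioo 0 T, HasDerivAt u (deriv u t) t :=
    fun hu t ht => ((hu.differentiableOn t ht).differentiableAt (Ioo_mem_nhds ht.1 ht.2)).hasDerivAt
  intro t ht
  refine sub_eq_zero.1 (h.eq_zero_of_hasDerivAt hM hlh (w := fun t => u t - u' t)
    (w' := fun t => deriv u t - deriv u' t) (hu.continuousOn.sub hu'.continuousOn)
    (fun t ht => (hd hu t ht).sub (hd hu' t ht)) (fun t ht => ?_) ?_ t ht)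
  · rw [h.map_sub hlh, map_sub, hu.equation t ht, hu'.equation t ht]
  · exact sub_eq_zero.2 (S.toV_injective hi (hu.initial.trans hu'.initial.symm))

end Uniqueness

/-! ### Dependence of the solution on the operator -/

section Convergence

variable {ι : Type*} {l : Filter ι} {B : ι → V → V}

/-- Induction through $B^{n+1}r-A^{n+1}r=B(B^nr-A^nr)+(B-A)A^nr$ with an intermediate space `E c`:
the first term uses the uniform bound on $B$, the second the strong convergence `hconv`. -/
theorem tendsto_iterate (h : S.IsSingular A M lo hi) (hB : ∀ᶠ i in l, S.IsSingular (B i) M lo hi)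
    (hM : 0 < M)
    (hconv : ∀ a b, lo ≤ b → b < a → a ≤ hi → ∀ x : E a, ∀ y : E b, S.toV b y = A (S.toV a x) →
      ∀ z : ι → E b, (∀ᶠ i in l, S.toV b (z i) = B i (S.toV a x)) → Tendsto z l (𝓝 y))
    (r : E hi) (n : ℕ) : ∀ b, lo ≤ b → b < hi → ∀ x : E b, S.toV b x = A^[n] (S.toV hi r) →
      ∀ z : ι → E b, (∀ᶠ i in l, S.toV b (z i) = (B i)^[n] (S.toV hi r)) →
        Tendsto z l (𝓝 x) := by
  induction n with
  | zero =>
    intro b hb1 hb2 x hx z hz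
    refine tendsto_const_nhds.congr' ?_
    filter_upwards [hz] with i hi
    exact S.toV_injective b (by rw [hx, hi]; rfl)
  | succ n ih =>
    intro b hb1 hb2 x hx z hz
    obtain ⟨c, hbc, hc⟩ := exists_between hb2
    obtain ⟨y, hy, -⟩ := h.exists_iterate hM r (hb1.trans hbc.le) hc n
    have hex : ∀ i, ∃ p : E c × E b, S.IsSingular (B i) M lo hi →
        S.toV c p.1 = (B i)^[n] (S.toV hi r) ∧ S.toV b p.2 = B i (S.toV c y) := by
      intro i
      by_cases hBi : S.IsSingular (B i) M lo hi
      · obtain ⟨p, hp, -⟩ := hBi.exists_iterate hM r (hb1.trans hbc.le) hc n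
        obtain ⟨L, hL, -⟩ := hBi c b hb1 hbc hc.le
        exact ⟨(p, L y), fun _ => ⟨hp, hL y⟩⟩
      -- Dummy values for the indices where `B i` is not singular; eventually there are none.
      · exact ⟨0, fun h => absurd h hBi⟩
    choose p hp using hex
    have h1 : Tendsto (fun i => (p i).1) l (𝓝 y) :=
      ih c (hb1.trans hbc.le) hc y hy _ (hB.mono fun i hi => (hp i hi).1)
    have h2 : Tendsto (fun i => (p i).2) l (𝓝 x) :=
      hconv c b hb1 hbc hc.le y x (by rw [hx, hy, Function.iterate_succ_apply']) _
        (hB.mono fun i hi => (hp i hi).2)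
    have h3 : Tendsto (fun i => M / (Real.exp 1 * (c - b)) * ‖(p i).1 - y‖ + ‖(p i).2 - x‖) l
        (𝓝 0) := by
      have h4 := (tendsto_iff_norm_sub_tendsto_zero.1 h1).const_mul (M / (Real.exp 1 * (c - b)))
      simpa using h4.add (tendsto_iff_norm_sub_tendsto_zero.1 h2)
    refine tendsto_iff_norm_sub_tendsto_zero.2
      (squeeze_zero' (Eventually.of_forall fun _ => norm_nonneg _) ?_ h3)
    filter_upwards [hB, hz] with i hBi hzi
    obtain ⟨L, hL, hLn⟩ := hBi c b hb1 hbc hc.le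
    have e : z i - x = L ((p i).1 - y) + ((p i).2 - x) := by
      have e1 : z i = L (p i).1 := S.toV_injective b (by
        rw [hzi, hL, (hp i hBi).1, Function.iterate_succ_apply'])
      have e2 : (p i).2 = L y := S.toV_injective b (by rw [(hp i hBi).2, hL])
      rw [e1, e2, _root_.map_sub]
      abel
    rw [e]
    exact (norm_add_le _ _).trans (add_le_add_left (hLn _) _)

variable [∀ a, CompleteSpace (E a)]

/-- Two stretches of the scale are used: `[lo, hi]` produces the series, and `[lo', lo]` identifies
the given solutions with them. For $t\le T$ the distance is at most $\sum T^n/n!\,\|c_{i,n}-a_n\|$,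
which tends to zero by dominated convergence. -/
theorem tendstoUniformlyOn_of_isSolution (h : S.IsSingular A M lo hi)
    (hB : ∀ᶠ i in l, S.IsSingular (B i) M lo hi) (hM : 0 < M) (hlh : lo < hi)
    (hconv : ∀ a b, lo ≤ b → b < a → a ≤ hi → ∀ x : E a, ∀ y : E b, S.toV b y = A (S.toV a x) →
      ∀ z : ι → E b, (∀ᶠ i in l, S.toV b (z i) = B i (S.toV a x)) → Tendsto z l (𝓝 y))
    {M' lo' : ℝ} (hlo' : lo' < lo) (hM' : 0 < M') (h' : S.IsSingular A M' lo' lo)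
    (hB' : ∀ᶠ i in l, S.IsSingular (B i) M' lo' lo)
    {r : E hi} {u : ℝ → E lo} {k : ι → ℝ → E lo}
    (hu : S.IsSolution A (S.toV hi r) ((hi - lo) / M) u)
    (hk : ∀ᶠ i in l, S.IsSolution (B i) (S.toV hi r) ((hi - lo) / M) (k i))
    {T : ℝ} (hT : T < (hi - lo) / M) : TendstoUniformlyOn k u l (Icc 0 T) := by
  rcases lt_or_ge T 0 with hT0 | hT0
  · rw [Icc_eq_empty hT0.not_ge]; exact tendstoUniformlyOn_empty
  have hlh' : 0 < hi - lo := sub_pos.2 hlh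
  obtain ⟨a, ha, han⟩ := h.exists_coeff hM hlh r
  have hex : ∀ i, ∃ c : ℕ → E lo, S.IsSingular (B i) M lo hi →
      (∀ n, S.toV lo (c n) = (B i)^[n] (S.toV hi r)) ∧
        ∀ n, ‖c n‖ ≤ (n.factorial : ℝ) * (M / (hi - lo)) ^ n * ‖r‖ := by
    intro i
    by_cases hBi : S.IsSingular (B i) M lo hi
    · obtain ⟨c, hc⟩ := hBi.exists_coeff hM hlh r
      exact ⟨c, fun _ => hc⟩
    · exact ⟨0, fun h => absurd h hBi⟩
  choose c hc using hex
  set q := T * (M / (hi - lo)) with hq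
  have hq0 : 0 ≤ q := by positivity
  have hq1 : q < 1 := by
    rw [hq, ← lt_div_iff₀ (by positivity), one_div_div]; exact hT
  have hbd : ∀ x y : E lo, ∀ n : ℕ, ‖x‖ ≤ (n.factorial : ℝ) * (M / (hi - lo)) ^ n * ‖r‖ →
      ‖y‖ ≤ (n.factorial : ℝ) * (M / (hi - lo)) ^ n * ‖r‖ →
      T ^ n / (n.factorial : ℝ) * ‖x - y‖ ≤ q ^ n * (2 * ‖r‖) := by
    intro x y n hx hy
    calc T ^ n / (n.factorial : ℝ) * ‖x - y‖
        ≤ T ^ n / (n.factorial : ℝ) * ((n.factorial : ℝ) * (M / (hi - lo)) ^ n * ‖r‖ +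
          (n.factorial : ℝ) * (M / (hi - lo)) ^ n * ‖r‖) := by
          gcongr
          exact (norm_sub_le _ _).trans (add_le_add hx hy)
      _ = q ^ n * (2 * ‖r‖) := by
          have : (n.factorial : ℝ) ≠ 0 := by positivity
          rw [hq, mul_pow]
          field_simp
          ring
  have hgeo : Summable fun n : ℕ => q ^ n * (2 * ‖r‖) :=
    (summable_geometric_of_lt_one hq0 hq1).mul_right _
  have hlim : Tendsto (fun i => ∑' n : ℕ, T ^ n / (n.factorial : ℝ) * ‖c i n - a n‖) l (𝓝 0) := by
    have := tendsto_tsum_of_dominated_convergence (𝓕 := l)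
      (f := fun i n => T ^ n / (n.factorial : ℝ) * ‖c i n - a n‖) (g := fun _ => (0 : ℝ)) hgeo
      (fun n => ?_) ?_
    · simpa using this
    · have := tendsto_iterate h hB hM hconv r n lo le_rfl hlh (a n) (ha n) (fun i => c i n)
        (hB.mono fun i hi => (hc i hi).1 n)
      simpa using (tendsto_iff_norm_sub_tendsto_zero.1 this).const_mul _
    · filter_upwards [hB] with i hi n
      rw [Real.norm_of_nonneg (by positivity)]
      exact hbd _ _ n ((hc i hi).2 n) (han n)
  rw [Metric.tendstoUniformlyOn_iff]
  intro ε hε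
  filter_upwards [hB, hB', hk, hlim.eventually_lt_const hε] with i hBi hBi' hki hlt t ht
  have htT : t ∈ Ico 0 ((hi - lo) / M) := ⟨ht.1, ht.2.trans_lt hT⟩
  have htabs : |t| < ((M / (hi - lo)))⁻¹ := by
    rw [abs_of_nonneg ht.1, inv_div]; exact htT.2
  rw [IsSolution.eqOn h' hM' hlo' hu (h.isSolution_expSeries hM hlh r a ha) htT,
    IsSolution.eqOn hBi' hM' hlo' hki (hBi.isSolution_expSeries hM hlh r (c i) (hc i hBi).1) htT,
    dist_comm, dist_eq_norm]
  have hpos : 0 < M / (hi - lo) := by positivity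
  have hs1 := (ExpSummable.of_le hpos (hc i hBi).2).summable htabs
  have hs2 := (ExpSummable.of_le hpos han).summable htabs
  rw [expSeries, expSeries, ← hs1.tsum_sub hs2]
  refine lt_of_le_of_lt ?_ hlt
  have hs3 : Summable fun n : ℕ => T ^ n / (n.factorial : ℝ) * ‖c i n - a n‖ :=
    Summable.of_nonneg_of_le (fun n => by positivity)
      (fun n => hbd _ _ n ((hc i hBi).2 n) (han n)) hgeo
  refine tsum_of_norm_bounded hs3.hasSum fun n => ?_
  rw [← smul_sub, norm_smul, norm_div, norm_pow, Real.norm_eq_abs, Real.norm_natCast,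
    abs_of_nonneg ht.1]
  gcongr
  exacts [ht.1, ht.2]

end Convergence


end NormedScale
end GlauberVlasov

namespace GlauberVlasov

/-! ### Configurations as images of tuples -/

theorem measurable_of_forall_sigma {α ι γ : Type*} [MeasurableSpace α] [Countable ι]
    {X : ι → Type*} [∀ i, MeasurableSpace (X i)] [MeasurableSpace γ] {f : α × Sigma X → γ}
    (h : ∀ i, Measurable fun p : α × X i => f (p.1, ⟨i, p.2⟩)) : Measurable f := by
  have hemb : ∀ i, MeasurableEmbedding (Sigma.mk i : X i → Sigma X) := by
    intro i
    refine ⟨sigma_mk_injective, ?_, ?_⟩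
    · exact fun s hs => (MeasurableSpace.measurableSet_iInf.1 hs) i
    · intro s hs
      refine MeasurableSpace.measurableSet_iInf.2 fun j => ?_
      change MeasurableSet (Sigma.mk j ⁻¹' (Sigma.mk i '' s))
      by_cases hij : i = j
      · subst hij
        rwa [preimage_image_eq _ sigma_mk_injective]
      · convert MeasurableSet.empty
        ext y
        simp [hij]
  intro s hs
  have : f ⁻¹' s = ⋃ i, Prod.map id (Sigma.mk i) ''
      ((fun p : α × X i => f (p.1, ⟨i, p.2⟩)) ⁻¹' s) := by
    ext ⟨a, i, y⟩
    simp only [mem_preimage, mem_iUnion, mem_image, Prod.map_apply, id_eq, Prod.mk.injEq,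
      Prod.exists]
    constructor
    · exact fun hm => ⟨i, a, y, hm, rfl, rfl⟩
    · rintro ⟨j, b, z, hm, rfl, hz⟩
      cases hz
      exact hm
  rw [this]
  exact MeasurableSet.iUnion fun i =>
    (MeasurableEmbedding.id.prodMap (hemb i)).measurableSet_image' (h i hs)

variable {d : ℕ}

open Classical in
/-- The configuration `{x₁, …, x_n}` of a tuple whose points need not be distinct. -/
def conf (n : ℕ) (x : Fin n → Pt d) : FinConf d := ⟨Finset.univ.image x⟩

theorem conf_surjective (η : FinConf d) :
    ∃ x : Fin η.card → Pt d, Function.Injective x ∧ conf η.card x = η := by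
  classical
  refine ⟨fun i => η.points.equivFin.symm i, fun i j h => ?_, ?_⟩
  · exact η.points.equivFin.symm.injective (Subtype.ext h)
  · ext y
    simp only [conf, Finset.mem_image, Finset.mem_univ, true_and]
    constructor
    · rintro ⟨i, rfl⟩
      exact (η.points.equivFin.symm i).2
    · intro hy
      exact ⟨η.points.equivFin ⟨y, hy⟩, by simp⟩

theorem card_conf {n : ℕ} {x : Fin n → Pt d} (hx : Function.Injective x) :
    (conf n x).card = n := by
  simp [conf, FinConf.card, Finset.card_image_of_injective _ hx]

theorem conf_eq_conf_iff {m n : ℕ} {x : Fin n → Pt d} {y : Fin m → Pt d}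
    (hy : Function.Injective y) :
    conf n x = conf m y ↔ ∃ f : Fin n → Fin m, Function.Surjective f ∧ x = y ∘ f := by
  classical
  constructor
  · intro h
    have hp : Finset.univ.image x = Finset.univ.image y := congrArg FinConf.points h
    have hf : ∀ i, ∃ j, y j = x i := fun i => by
      have : x i ∈ Finset.univ.image y := hp ▸ Finset.mem_image_of_mem x (Finset.mem_univ i)
      simpa using this
    choose f hf using hf
    refine ⟨f, fun j => ?_, funext fun i => (hf i).symm⟩
    have : y j ∈ Finset.univ.image x := hp.symm ▸ Finset.mem_image_of_mem y (Finset.mem_univ j)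
    obtain ⟨i, -, hi⟩ := Finset.mem_image.1 this
    exact ⟨i, hy ((hf i).trans hi)⟩
  · rintro ⟨f, hf, rfl⟩
    ext z
    simp only [conf, Finset.mem_image, Finset.mem_univ, true_and, Function.comp]
    exact ⟨fun ⟨i, hi⟩ => ⟨f i, hi⟩, fun ⟨j, hj⟩ => by
      obtain ⟨i, rfl⟩ := hf j
      exact ⟨i, hj⟩⟩

theorem conf_union_conf {n m : ℕ} (x : Fin n → Pt d) (y : Fin m → Pt d) :
    (conf n x).union (conf m y) = conf (n + m) (Fin.append x y) := by
  classical
  ext z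
  simp only [conf, FinConf.union, Finset.mem_union, Finset.mem_image, Finset.mem_univ, true_and]
  constructor
  · rintro (⟨i, rfl⟩ | ⟨i, rfl⟩)
    · exact ⟨Fin.castAdd m i, by simp⟩
    · exact ⟨Fin.natAdd n i, by simp⟩
  · rintro ⟨i, rfl⟩
    refine Fin.addCases (fun i => ?_) (fun i => ?_) i
    · exact Or.inl ⟨i, by simp⟩
    · exact Or.inr ⟨i, by simp⟩

theorem conf_erase {n : ℕ} {x : Fin (n + 1) → Pt d} (hx : Function.Injective x)
    (i : Fin (n + 1)) : (conf (n + 1) x).erase (x i) = conf n fun j => x (i.succAbove j) := by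
  classical
  ext z
  simp only [conf, FinConf.erase, Finset.mem_erase, Finset.mem_image, Finset.mem_univ, true_and]
  constructor
  · rintro ⟨hz, j, rfl⟩
    obtain ⟨k, rfl⟩ := Fin.exists_succAbove_eq (x := j) (y := i) (fun h => hz (by rw [h]))
    exact ⟨k, rfl⟩
  · rintro ⟨j, rfl⟩
    exact ⟨fun h => Fin.succAbove_ne i j (hx h), _, rfl⟩

theorem sum_conf {n : ℕ} {x : Fin n → Pt d} (hx : Function.Injective x) (f : Pt d → ℝ) :
    ∑ y ∈ (conf n x).points, f y = ∑ i, f (x i) :=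
  Finset.sum_image fun _ _ _ _ h => hx h

theorem lpExp_conf {n : ℕ} {x : Fin n → Pt d} (hx : Function.Injective x) (f : Pt d → ℝ) :
    lpExp f (conf n x) = ∏ i, f (x i) :=
  Finset.prod_image fun _ _ _ _ h => hx h

/-! ### Measurability on the configuration space -/

theorem measurableSet_injective (n : ℕ) :
    MeasurableSet {x : Fin n → Pt d | Function.Injective x} := by
  have : {x : Fin n → Pt d | Function.Injective x} =
      ⋂ i, ⋂ j, {x | x i = x j → i = j} := by
    ext x; simp [Function.Injective]
  rw [this]
  refine MeasurableSet.iInter fun i => MeasurableSet.iInter fun j => ?_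
  by_cases h : i = j
  · simp [h]
  · have : {x : Fin n → Pt d | x i = x j → i = j} = {x | x i = x j}ᶜ := by
      ext x; simp [h]
    rw [this]
    exact (measurableSet_eq_fun (measurable_pi_apply i) (measurable_pi_apply j)).compl

theorem measurable_iff_forall_conf {γ : Type*} [MeasurableSpace γ] {f : FinConf d → γ} :
    Measurable f ↔ ∀ n, Measurable fun x : DistinctTuples d n => f (conf n x.1) := by
  constructor
  · intro hf n s hs
    exact (MeasurableSpace.measurableSet_iInf.1 (hf hs)) n
  · intro h s hs
    exact MeasurableSpace.measurableSet_iInf.2 fun n => h n hs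

theorem measurableSet_iff_forall_conf {s : Set (FinConf d)} :
    MeasurableSet s ↔ ∀ n, MeasurableSet {x : DistinctTuples d n | conf n x.1 ∈ s} :=
  MeasurableSpace.measurableSet_iInf

/-- The $\sigma$-algebra tests only tuples of distinct points, so general tuples are sorted by their
coincidence patterns: `g` records which entries agree and `f` selects one representative of each
value. -/
theorem measurable_conf (n : ℕ) : Measurable (conf n : (Fin n → Pt d) → FinConf d) := by
  classical
  intro s hs
  have key : ∀ m, MeasurableSet {y : Fin m → Pt d | Function.Injective y ∧ conf m y ∈ s} := by
    intro m
    have : {y : Fin m → Pt d | Function.Injective y ∧ conf m y ∈ s} =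
        Subtype.val '' {x : DistinctTuples d m | conf m x.1 ∈ s} := by
      ext y
      simp [and_comm]
    rw [this]
    exact (measurableSet_injective m).subtype_image (measurableSet_iff_forall_conf.1 hs m)
  have : conf n ⁻¹' s = ⋃ m : Fin (n + 1), ⋃ f : Fin m → Fin n, ⋃ g : Fin n → Fin m,
      ({x : Fin n → Pt d | x = x ∘ f ∘ g} ∩ {x | ∃ _ : Function.Surjective g, True} ∩
        (fun x => x ∘ f) ⁻¹' {y : Fin m → Pt d | Function.Injective y ∧ conf m y ∈ s}) := by
    ext x
    simp only [mem_preimage, mem_iUnion, mem_inter_iff, mem_ofPred_eq, exists_prop, and_true]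
    constructor
    · intro hx
      obtain ⟨y, hy, hyx⟩ := conf_surjective (conf n x)
      obtain ⟨g, hg, hxg⟩ := (conf_eq_conf_iff hy).1 hyx.symm
      obtain ⟨f, hf⟩ := hg.hasRightInverse
      have hm : (conf n x).card < n + 1 :=
        Nat.lt_succ_of_le (by simpa using Fintype.card_le_of_surjective g hg)
      have hxf : x ∘ f = y := by
        funext j
        have := congrFun hxg (f j)
        rwa [Function.comp_apply, hf j] at this
      refine ⟨⟨_, hm⟩, f, g, ⟨?_, hg⟩, ?_⟩
      · rw [← Function.comp_assoc, hxf]; exact hxg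
      · rw [hxf]; exact ⟨hy, by simpa [hyx] using hx⟩
    · rintro ⟨m, f, g, ⟨h1, hg⟩, h2, h3⟩
      rwa [(conf_eq_conf_iff h2).2 ⟨g, hg, h1⟩]
  rw [this]
  refine MeasurableSet.iUnion fun m => MeasurableSet.iUnion fun f => MeasurableSet.iUnion fun g => ?_
  refine ((measurableSet_eq_fun measurable_id ?_).inter (MeasurableSet.const _)).inter
    ((key m).preimage ?_)
  · exact measurable_pi_lambda _ fun i => measurable_pi_apply _
  · exact measurable_pi_lambda _ fun i => measurable_pi_apply _

theorem measurable_append {n m : ℕ} :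
    Measurable fun p : (Fin n → Pt d) × (Fin m → Pt d) => Fin.append p.1 p.2 := by
  refine measurable_pi_lambda _ fun i => ?_
  refine Fin.addCases (fun i => ?_) (fun i => ?_) i
  · simpa [Function.comp_def] using
      (measurable_pi_apply (X := fun _ => Pt d) i).comp measurable_fst
  · simpa [Function.comp_def] using
      (measurable_pi_apply (X := fun _ => Pt d) i).comp measurable_snd

theorem measurable_card : Measurable (FinConf.card : FinConf d → ℕ) :=
  measurable_iff_forall_conf.2 fun n => by
    have : (fun x : DistinctTuples d n => (conf n x.1).card) = fun _ => n :=
      funext fun x => card_conf x.2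
    rw [this]; exact measurable_const

theorem measurable_lpExp {f : Pt d → ℝ} (hf : Measurable f) : Measurable (lpExp f) :=
  measurable_iff_forall_conf.2 fun n => by
    have : (fun x : DistinctTuples d n => lpExp f (conf n x.1)) = fun x => ∏ i, f (x.1 i) :=
      funext fun x => lpExp_conf x.2 f
    rw [this]
    exact Finset.measurable_prod _ fun i _ =>
      hf.comp ((measurable_pi_apply i).comp measurable_subtype_coe)

theorem measurable_union (η : FinConf d) : Measurable η.union := by
  obtain ⟨x, -, hx⟩ := conf_surjective η
  refine measurable_iff_forall_conf.2 fun n => ?_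
  have : (fun y : DistinctTuples d n => η.union (conf n y.1)) =
      fun y => conf _ (Fin.append x y.1) := funext fun y => by
    rw [← conf_union_conf, hx]
  rw [this]
  exact (measurable_conf _).comp (measurable_append.comp
    (measurable_const.prodMk measurable_subtype_coe))

/-! ### The Lebesgue–Poisson measure -/

/-- For $d\ge1$ each diagonal $x_i=x_j$ is a proper subspace, hence null. -/
theorem ae_injective (hd : 1 ≤ d) (n : ℕ) : ∀ᵐ x : Fin n → Pt d, Function.Injective x := by
  have : ∀ i j : Fin n, ∀ᵐ x : Fin n → Pt d, x i = x j → i = j := by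
    intro i j
    by_cases hij : i = j
    · simp [hij]
    let s : Submodule ℝ (Fin n → Pt d) :=
      LinearMap.ker (LinearMap.proj (R := ℝ) (φ := fun _ : Fin n => Pt d) i - LinearMap.proj j)
    have hs : s ≠ ⊤ := by
      intro h
      have : Nonempty (Fin d) := ⟨⟨0, hd⟩⟩
      obtain ⟨v, hv⟩ := exists_ne (0 : Pt d)
      have : Function.update (0 : Fin n → Pt d) i v ∈ s := h ▸ Submodule.mem_top
      simp [s, Ne.symm hij] at this
      exact hv this
    have h0 := Measure.addHaar_submodule (volume : Measure (Fin n → Pt d)) s hs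
    rw [ae_iff]
    convert h0 using 2
    ext x
    simp [s, hij, sub_eq_zero]
  filter_upwards [ae_all_iff.2 fun i => ae_all_iff.2 (this i)] with x hx i j using hx i j

theorem levelMeasure_eq_map (hd : 1 ≤ d) (n : ℕ) : levelMeasure d n = volume.map (conf n) := by
  have h1 : (toConf n : DistinctTuples d n → FinConf d) = conf n ∘ Subtype.val := rfl
  have h2 : (Measure.comap (Subtype.val : DistinctTuples d n → (Fin n → Pt d)) volume).map
      Subtype.val = volume := by
    have := map_comap_subtype_coe (measurableSet_injective (d := d) n) volume
    refine this.trans ?_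
    exact Measure.restrict_eq_self_of_ae_mem (ae_injective hd n)
  rw [levelMeasure, h1, ← Measure.map_map (measurable_conf n) measurable_subtype_coe, h2]

/-- For the converse direction `p` need not be measurable, and a measurable null cover `N` of the
bad tuples need not be symmetric. The configurations all of whose $n$-tuple labellings lie in `N`
form a measurable set, because for each cardinality only finitely many labellings occur; it contains
the bad configurations and its preimage lies in `N`. -/
theorem ae_lebesguePoisson_iff (hd : 1 ≤ d) {p : FinConf d → Prop} :
    (∀ᵐ η ∂(lebesguePoisson d), p η) ↔ ∀ n, ∀ᵐ x : Fin n → Pt d, p (conf n x) := by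
  have h1 : (∀ᵐ η ∂(lebesguePoisson d), p η) ↔
      ∀ n, ∀ᵐ η ∂((volume : Measure (Fin n → Pt d)).map (conf n)), p η := by
    rw [lebesguePoisson, Measure.ae_sum_iff]
    refine forall_congr' fun n => ?_
    rw [levelMeasure_eq_map hd,
      Measure.ae_ennreal_smul_measure_iff (ENNReal.inv_ne_zero.2 (ENNReal.natCast_ne_top _))]
  rw [h1]
  refine forall_congr' fun n => ⟨ae_of_ae_map (measurable_conf n).aemeasurable, fun h => ?_⟩
  set N := toMeasurable volume {x : Fin n → Pt d | ¬ p (conf n x)} with hN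
  have hN0 : volume N = 0 := by rw [hN, measure_toMeasurable]; exact h
  have hNm : MeasurableSet N := measurableSet_toMeasurable _ _
  -- the saturation of `N` under relabelling of the points
  let s : Set (FinConf d) := {η | ∀ x : Fin n → Pt d, conf n x = η → x ∈ N}
  have hs : MeasurableSet s := by
    refine measurableSet_iff_forall_conf.2 fun m => ?_
    have : {y : DistinctTuples d m | conf m y.1 ∈ s} =
        ⋂ f : {f : Fin n → Fin m // Function.Surjective f}, {y | y.1 ∘ f.1 ∈ N} := by
      ext y
      simp only [s, mem_ofPred_eq, mem_iInter, conf_eq_conf_iff y.2]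
      exact ⟨fun h f => h _ ⟨f.1, f.2, rfl⟩, fun h x ⟨f, hf, hx⟩ => hx ▸ h ⟨f, hf⟩⟩
    rw [this]
    refine MeasurableSet.iInter fun f => hNm.preimage ?_
    exact measurable_pi_lambda _ fun i => (measurable_pi_apply _).comp measurable_subtype_coe
  rw [ae_iff]
  refine measure_mono_null (t := s) ?_ ?_
  · rintro η hη x rfl
    exact subset_toMeasurable _ _ hη
  · rw [Measure.map_apply (measurable_conf n) hs]
    exact measure_mono_null (fun x hx => hx x rfl) hN0

theorem measurePreserving_append (n m : ℕ) :
    MeasurePreserving (fun p : (Fin n → Pt d) × (Fin m → Pt d) => Fin.append p.1 p.2) := by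
  refine ⟨measurable_append, (Measure.pi_eq fun s hs => ?_).symm⟩
  rw [Measure.map_apply measurable_append (MeasurableSet.univ_pi hs)]
  have : (fun p : (Fin n → Pt d) × (Fin m → Pt d) => Fin.append p.1 p.2) ⁻¹' univ.pi s =
      (univ.pi fun i => s (Fin.castAdd m i)) ×ˢ (univ.pi fun i => s (Fin.natAdd n i)) := by
    ext p
    simp only [mem_preimage, Set.mem_pi, mem_univ, true_imp_iff, mem_prod]
    refine ⟨fun h => ⟨fun i => by simpa using h (Fin.castAdd m i),
      fun i => by simpa using h (Fin.natAdd n i)⟩, fun h i => ?_⟩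
    refine Fin.addCases (fun i => ?_) (fun i => ?_) i
    · simpa using h.1 i
    · simpa using h.2 i
  rw [this, Measure.volume_eq_prod, Measure.prod_prod, volume_pi_pi, volume_pi_pi,
    Fin.prod_univ_add]

theorem ae_ae_union (hd : 1 ≤ d) {p : FinConf d → Prop} (h : ∀ᵐ η ∂(lebesguePoisson d), p η) :
    ∀ᵐ η ∂(lebesguePoisson d), ∀ᵐ ξ ∂(lebesguePoisson d), p (η.union ξ) := by
  rw [ae_lebesguePoisson_iff hd] at h
  simp only [ae_lebesguePoisson_iff hd, ae_all_iff, conf_union_conf]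
  intro n m
  exact Measure.ae_ae_of_ae_prod ((measurePreserving_append n m).quasiMeasurePreserving.ae (h _))

theorem ae_erase (hd : 1 ≤ d) {p : FinConf d → Prop} (h : ∀ᵐ η ∂(lebesguePoisson d), p η) :
    ∀ᵐ η ∂(lebesguePoisson d), ∀ x ∈ η.points, p (η.erase x) := by
  classical
  rw [ae_lebesguePoisson_iff hd] at h ⊢
  rintro (_ | n)
  · simp [conf]
  · have : ∀ i : Fin (n + 1), ∀ᵐ x : Fin (n + 1) → Pt d, p (conf n fun j => x (i.succAbove j)) :=
      fun i => by
        have h1 := (volume_preserving_piFinSuccAbove (fun _ : Fin (n + 1) => Pt d)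
          i).quasiMeasurePreserving
        have h2 : ∀ᵐ q : Pt d × (Fin n → Pt d), p (conf n q.2) :=
          (Measure.quasiMeasurePreserving_snd (μ := (volume : Measure (Pt d)))).ae (h n)
        exact h1.ae h2
    filter_upwards [ae_all_iff.2 this, ae_injective hd (n + 1)] with x hx hinj y hy
    obtain ⟨i, -, rfl⟩ := Finset.mem_image.1 hy
    rw [conf_erase hinj]
    exact hx i

theorem ae_erase_union (hd : 1 ≤ d) {p : FinConf d → Prop}
    (h : ∀ᵐ η ∂(lebesguePoisson d), p η) :
    ∀ᵐ η ∂(lebesguePoisson d), ∀ x ∈ η.points, ∀ᵐ ξ ∂(lebesguePoisson d),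
      p ((η.erase x).union ξ) :=
  ae_erase hd (p := fun η => ∀ᵐ ξ ∂(lebesguePoisson d), p (η.union ξ)) (ae_ae_union hd h)

theorem ae_forall_mem (hd : 1 ≤ d) {p : Pt d → Prop} (h : ∀ᵐ x, p x) :
    ∀ᵐ ξ ∂(lebesguePoisson d), ∀ x ∈ ξ.points, p x := by
  classical
  rw [ae_lebesguePoisson_iff hd]
  intro n
  have : ∀ i : Fin n, ∀ᵐ x : Fin n → Pt d, p (x i) := fun i =>
    (Measure.quasiMeasurePreserving_eval (fun _ => volume) i).ae h
  filter_upwards [ae_all_iff.2 this] with x hx y hy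
  obtain ⟨i, -, rfl⟩ := Finset.mem_image.1 hy
  exact hx i

theorem ae_disjoint (hd : 1 ≤ d) (η : FinConf d) :
    ∀ᵐ ξ ∂(lebesguePoisson d), Disjoint η.points ξ.points := by
  have : Nonempty (Fin d) := ⟨⟨0, hd⟩⟩
  have h : ∀ᵐ x : Pt d, x ∉ η.points := by
    rw [ae_iff]
    simpa using (η.points.finite_toSet.measure_zero volume)
  filter_upwards [ae_forall_mem hd h] with ξ hξ
  exact Finset.disjoint_right.2 hξ

theorem ae_card_union (hd : 1 ≤ d) (η : FinConf d) :
    ∀ᵐ ξ ∂(lebesguePoisson d), (η.union ξ).card = η.card + ξ.card := by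
  classical
  filter_upwards [ae_disjoint hd η] with ξ hξ
  simp only [FinConf.card, FinConf.union]
  exact Finset.card_union_of_disjoint hξ

/-- Almost every configuration has all its differences in a conull set. -/
theorem ae_forall_sub (hd : 1 ≤ d) {p : Pt d → Prop} (h : ∀ᵐ x, p x) :
    ∀ᵐ η ∂(lebesguePoisson d), ∀ x ∈ η.points, ∀ y ∈ (η.erase x).points, p (x - y) := by
  classical
  rw [ae_lebesguePoisson_iff hd]
  intro n
  have : ∀ i j : Fin n, ∀ᵐ x : Fin n → Pt d, i ≠ j → p (x i - x j) := by
    intro i j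
    by_cases hij : i = j
    · simp [hij]
    let D : (Fin n → Pt d) →ₗ[ℝ] Pt d :=
      LinearMap.proj (R := ℝ) (φ := fun _ : Fin n => Pt d) i - LinearMap.proj j
    have hD : ∀ x, D x = x i - x j := fun x => rfl
    have hsurj : Function.Surjective D := fun v =>
      ⟨Function.update (0 : Fin n → Pt d) i v, by
        rw [hD, Function.update_self, Function.update_of_ne (Ne.symm hij), Pi.zero_apply,
          sub_zero]⟩
    -- A measurable conull set inside `p`, as the transfer along the surjective linear map `D` needs
    -- measurability.
    set t := (toMeasurable volume {x : Pt d | ¬ p x})ᶜ with ht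
    have hts : ∀ x ∈ t, p x := fun x hx => by
      by_contra hpx
      exact hx (subset_toMeasurable _ _ hpx)
    have ht0 : ∀ᵐ x, x ∈ t := by
      rw [ae_iff]
      simpa [ht, measure_toMeasurable] using! h
    have := (ae_comp_linearMap_mem_iff D (volume : Measure (Fin n → Pt d))
      (volume : Measure (Pt d)) hsurj (measurableSet_toMeasurable _ _).compl).2 ht0
    filter_upwards [this] with x hx _ using hts _ hx
  filter_upwards [ae_all_iff.2 fun i => ae_all_iff.2 (this i)] with x hx y hy z hz
  obtain ⟨i, -, rfl⟩ := Finset.mem_image.1 hy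
  obtain ⟨hzi, hz⟩ := Finset.mem_erase.1 hz
  obtain ⟨j, -, rfl⟩ := Finset.mem_image.1 hz
  exact hx i j fun hij => hzi (by rw [hij])

theorem lintegral_lebesguePoisson (hd : 1 ≤ d) {F : FinConf d → ENNReal} (hF : Measurable F) :
    ∫⁻ ξ, F ξ ∂(lebesguePoisson d) =
      ∑' n : ℕ, ((n.factorial : ENNReal)⁻¹) * ∫⁻ x : Fin n → Pt d, F (conf n x) := by
  rw [lebesguePoisson, lintegral_sum_measure]
  refine tsum_congr fun n => ?_
  rw [lintegral_smul_measure, levelMeasure_eq_map hd, lintegral_map hF (measurable_conf n),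
    smul_eq_mul]

/-- On $n$-tuples the exponent is a product, so level $n$ contributes $(\int f)^n/n!$. -/
theorem lintegral_lpExp (hd : 1 ≤ d) {f : Pt d → ℝ} (hf : Measurable f) (h0 : ∀ x, 0 ≤ f x)
    (hi : Integrable f) : ∫⁻ ξ, ENNReal.ofReal (lpExp f ξ) ∂(lebesguePoisson d) =
      ENNReal.ofReal (Real.exp (∫ x, f x)) := by
  rw [lintegral_lebesguePoisson hd (measurable_lpExp hf).ennreal_ofReal, Real.exp_eq_exp_ℝ,
    NormedSpace.exp_eq_tsum_div, ENNReal.ofReal_tsum_of_nonneg]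
  · refine tsum_congr fun n => ?_
    have h1 : ∫⁻ x : Fin n → Pt d, ENNReal.ofReal (lpExp f (conf n x)) =
        ∫⁻ x : Fin n → Pt d, ENNReal.ofReal (∏ i, f (x i)) := by
      refine lintegral_congr_ae ?_
      filter_upwards [ae_injective hd n] with x hx
      rw [lpExp_conf hx]
    have h2 : Integrable (fun x : Fin n → Pt d => ∏ i, f (x i)) :=
      Integrable.fintype_prod (f := fun _ => f) fun _ => hi
    rw [h1, ← ofReal_integral_eq_lintegral_ofReal h2
      (Eventually.of_forall fun x => Finset.prod_nonneg fun i _ => h0 _),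
      integral_fintype_prod_volume_eq_pow, Fintype.card_fin, div_eq_inv_mul,
      ENNReal.ofReal_mul (by positivity), ENNReal.ofReal_inv_of_pos (by positivity),
      ENNReal.ofReal_natCast]
  · intro n
    have : 0 ≤ ∫ x, f x := integral_nonneg h0
    positivity
  · exact NormedSpace.expSeries_div_summable (𝔸 := ℝ) _

theorem lpExp_nonneg {f : Pt d → ℝ} (h0 : ∀ x, 0 ≤ f x) (ξ : FinConf d) : 0 ≤ lpExp f ξ :=
  Finset.prod_nonneg fun _ _ => h0 _

theorem integrable_lpExp (hd : 1 ≤ d) {f : Pt d → ℝ} (hf : Measurable f) (h0 : ∀ x, 0 ≤ f x)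
    (hi : Integrable f) : Integrable (lpExp f) (lebesguePoisson d) := by
  refine ⟨(measurable_lpExp hf).aestronglyMeasurable, ?_⟩
  rw [hasFiniteIntegral_iff_ofReal (Eventually.of_forall (lpExp_nonneg h0)),
    lintegral_lpExp hd hf h0 hi]
  exact ENNReal.ofReal_lt_top

theorem integral_lpExp (hd : 1 ≤ d) {f : Pt d → ℝ} (hf : Measurable f) (h0 : ∀ x, 0 ≤ f x)
    (hi : Integrable f) : ∫ ξ, lpExp f ξ ∂(lebesguePoisson d) = Real.exp (∫ x, f x) := by
  rw [integral_eq_lintegral_of_nonneg_ae (Eventually.of_forall (lpExp_nonneg h0))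
    (measurable_lpExp hf).aestronglyMeasurable, lintegral_lpExp hd hf h0 hi,
    ENNReal.toReal_ofReal (Real.exp_pos _).le]

/-- A measure on tuples of all lengths which represents the Lebesgue–Poisson measure. -/
def tupleMeasure (d : ℕ) : Measure (Σ n : ℕ, Fin n → Pt d) :=
  Measure.sum fun n : ℕ => ((n.factorial : ENNReal)⁻¹) •
    (volume : Measure (Fin n → Pt d)).map (Sigma.mk n)

instance : SFinite (tupleMeasure d) := by unfold tupleMeasure; infer_instance

theorem measurable_sigma_mk (n : ℕ) :
    Measurable (fun x : Fin n → Pt d => (⟨n, x⟩ : Σ n : ℕ, Fin n → Pt d)) :=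
  fun _ hs => (MeasurableSpace.measurableSet_iInf.1 hs) n

theorem measurable_sigma_conf :
    Measurable fun z : (Σ n : ℕ, Fin n → Pt d) => conf z.1 z.2 :=
  fun _ hs => MeasurableSpace.measurableSet_iInf.2 fun n => measurable_conf n hs

theorem map_tupleMeasure (hd : 1 ≤ d) :
    (tupleMeasure d).map (fun z => conf z.1 z.2) = lebesguePoisson d := by
  rw [tupleMeasure, Measure.map_sum measurable_sigma_conf.aemeasurable, lebesguePoisson]
  congr 1
  funext n
  rw [Measure.map_smul, Measure.map_map measurable_sigma_conf (measurable_sigma_mk n),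
    levelMeasure_eq_map hd]
  rfl

theorem ae_tupleMeasure_injective (hd : 1 ≤ d) :
    ∀ᵐ z ∂(tupleMeasure d), Function.Injective z.2 := by
  rw [tupleMeasure, Measure.ae_sum_iff]
  intro n
  rw [Measure.ae_ennreal_smul_measure_iff (ENNReal.inv_ne_zero.2 (ENNReal.natCast_ne_top _)),
    ae_map_iff (measurable_sigma_mk n).aemeasurable]
  · exact ae_injective hd n
  · exact MeasurableSpace.measurableSet_iInf.2 fun m => measurableSet_injective m

/-- Joint measurability of `∫ e(G(x - ·), ξ) k({y₁, …, y_n} ∪ ξ) λ(dξ)` in `x, y₁, …, y_n`. -/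
theorem measurable_integral_lpExp_mul (hd : 1 ≤ d) {G : Pt d → ℝ} (hG : Measurable G)
    {k : FinConf d → ℝ} (hk : Measurable k) (n : ℕ) :
    Measurable fun p : Pt d × (Fin n → Pt d) =>
      ∫ ξ, lpExp (fun y => G (p.1 - y)) ξ * k ((conf n p.2).union ξ) ∂(lebesguePoisson d) := by
  -- Over tuples the integrand has an explicit form, jointly measurable for each length, and
  -- `tupleMeasure` is s-finite, so measurability of parametric integrals applies.
  have h1 : ∀ p : Pt d × (Fin n → Pt d),
      ∫ ξ, lpExp (fun y => G (p.1 - y)) ξ * k ((conf n p.2).union ξ) ∂(lebesguePoisson d) =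
      ∫ z, (∏ i, G (p.1 - z.2 i)) * k (conf _ (Fin.append p.2 z.2)) ∂(tupleMeasure d) := by
    intro p
    have hm : Measurable fun ξ => lpExp (fun y => G (p.1 - y)) ξ * k ((conf n p.2).union ξ) :=
      (measurable_lpExp (hG.comp (measurable_const.sub measurable_id))).mul
        (hk.comp (measurable_union _))
    rw [← map_tupleMeasure hd, integral_map measurable_sigma_conf.aemeasurable
      hm.aestronglyMeasurable]
    refine integral_congr_ae ?_
    filter_upwards [ae_tupleMeasure_injective hd] with z hz
    rw [lpExp_conf hz, conf_union_conf]
  simp only [h1]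
  refine (StronglyMeasurable.integral_prod_right (ν := tupleMeasure d)
    (f := fun (p : Pt d × (Fin n → Pt d)) z =>
      (∏ i, G (p.1 - z.2 i)) * k (conf _ (Fin.append p.2 z.2))) ?_).measurable
  refine (measurable_of_forall_sigma fun m => ?_).stronglyMeasurable
  have h2 : Measurable fun p : (Pt d × (Fin n → Pt d)) × (Fin m → Pt d) =>
      ∏ i, G (p.1.1 - p.2 i) := Finset.measurable_prod _ fun i _ => hG.comp
    ((measurable_fst.comp measurable_fst).sub ((measurable_pi_apply i).comp measurable_snd))
  have h3 : Measurable fun p : (Pt d × (Fin n → Pt d)) × (Fin m → Pt d) =>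
      k (conf (n + m) (Fin.append p.1.2 p.2)) := hk.comp ((measurable_conf (n + m)).comp
    (measurable_append.comp ((measurable_snd.comp measurable_fst).prodMk measurable_snd)))
  exact h2.mul h3

end GlauberVlasov

namespace GlauberVlasov

variable {d : ℕ}

/-! ### A common form of the generators -/

/-- The operator `-|η| k(η) + ϰ ∑_{x ∈ η} e(C(x - ·), η \ x) ∫ e(G(x - ·), ξ) k((η \ x) ∪ ξ) λ(dξ)`,
of which both `L_{ε,ren}` and `L_V` are special cases. -/
def glauberOp (ϰ : ℝ) (C G : Pt d → ℝ) (k : FinConf d → ℝ) (η : FinConf d) : ℝ :=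
  -(η.card : ℝ) * k η + ϰ * ∑ x ∈ η.points, lpExp (fun y => C (x - y)) (η.erase x) *
    ∫ ξ, lpExp (fun y => G (x - y)) ξ * k ((η.erase x).union ξ) ∂(lebesguePoisson d)

theorem LVlasov_eq_glauberOp (ϰ : ℝ) (φ : Pt d → ℝ) (k : FinConf d → ℝ) :
    LVlasov ϰ φ k = glauberOp ϰ (fun _ => 1) (fun x => -φ x) k := by
  funext η
  simp [LVlasov, glauberOp, lpExp]

theorem card_erase_add_one {η : FinConf d} {x : Pt d} (hx : x ∈ η.points) :
    (η.erase x).card + 1 = η.card := by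
  classical
  exact Finset.card_erase_add_one hx

theorem lpExp_const_mul (c : ℝ) (f : Pt d → ℝ) (ξ : FinConf d) :
    lpExp (fun y => c * f y) ξ = c ^ ξ.card * lpExp f ξ := by
  simp [lpExp, FinConf.card, Finset.prod_mul_distrib]

/-- The factor $\varepsilon^{-1}$ of the activity supplies the power lost by deleting $x$, and
$\varepsilon^{-|\xi|}$ enters the kernel. The exceptional set concerns only $\xi$, so equality holds
at every $\eta$. -/
theorem LRen_eq_glauberOp (hd : 1 ≤ d) (ϰ : ℝ) (φ : Pt d → ℝ) {ε : ℝ} (hε : 0 < ε)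
    (k : FinConf d → ℝ) : LRen ϰ φ ε k = glauberOp ϰ (fun x => Real.exp (-(ε * φ x)))
      (fun x => ε⁻¹ * (Real.exp (-(ε * φ x)) - 1)) k := by
  funext η
  have h1 : ∀ x ∈ η.points, ∫ ξ, lpExp (fun y => tau (fun x => ε * φ x) x y - 1) ξ *
        rescale ε⁻¹ k ((η.erase x).union ξ) ∂(lebesguePoisson d) =
      ε⁻¹ ^ (η.erase x).card * ∫ ξ, lpExp (fun y => ε⁻¹ * (Real.exp (-(ε * φ (x - y))) - 1)) ξ *
        k ((η.erase x).union ξ) ∂(lebesguePoisson d) := by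
    intro x _
    rw [← integral_const_mul]
    refine integral_congr_ae ?_
    filter_upwards [ae_card_union hd (η.erase x)] with ξ hξ
    rw [lpExp_const_mul, rescale, hξ, pow_add]
    simp only [tau]
    ring
  have h2 : ε ^ η.card * ε⁻¹ ^ η.card = 1 := by
    rw [← mul_pow, mul_inv_cancel₀ hε.ne', one_pow]
  rw [LRen, rescale, LDelta, glauberOp, mul_add, rescale]
  congr 1
  · calc _ = (ε ^ η.card * ε⁻¹ ^ η.card) * (-(η.card : ℝ) * k η) := by ring
      _ = _ := by rw [h2, one_mul]
  · rw [Finset.mul_sum, Finset.mul_sum, Finset.mul_sum]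
    refine Finset.sum_congr rfl fun x hx => ?_
    rw [h1 x hx]
    have h3 : ε⁻¹ ^ η.card = ε⁻¹ ^ (η.erase x).card * ε⁻¹ := by
      rw [← card_erase_add_one hx, pow_succ]
    rw [h3] at h2
    set I := ∫ ξ, lpExp (fun y => ε⁻¹ * (Real.exp (-(ε * φ (x - y))) - 1)) ξ *
        k ((η.erase x).union ξ) ∂(lebesguePoisson d)
    set P := lpExp (fun y => Real.exp (-(ε * φ (x - y)))) (η.erase x) with hP
    have hP' : lpExp (tau (fun x => ε * φ x) x) (η.erase x) = P := rfl
    rw [hP']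
    calc _ = (ε ^ η.card * (ε⁻¹ ^ (η.erase x).card * ε⁻¹)) * (ϰ * (P * I)) := by ring
      _ = _ := by rw [h2, one_mul]

theorem glauberOp_congr_kernel (hd : 1 ≤ d) (ϰ : ℝ) {C C' G G' : Pt d → ℝ} (hC : C =ᵐ[volume] C')
    (hG : G =ᵐ[volume] G') (k : FinConf d → ℝ) :
    glauberOp ϰ C G k =ᵐ[lebesguePoisson d] glauberOp ϰ C' G' k := by
  filter_upwards [ae_forall_sub hd hC] with η hη
  rw [glauberOp, glauberOp]
  congr 2
  refine Finset.sum_congr rfl fun x hx => ?_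
  congr 1
  · exact Finset.prod_congr rfl fun y hy => hη x hx y hy
  · refine integral_congr_ae ?_
    have h : ∀ᵐ y, G (x - y) = G' (x - y) :=
      (Measure.measurePreserving_sub_left volume x).quasiMeasurePreserving.ae hG
    filter_upwards [ae_forall_mem hd h] with ξ hξ
    congr 1
    exact Finset.prod_congr rfl fun y hy => hξ y hy

/-- The operator is well defined on classes, although it evaluates $k$ at $(\eta\setminus
x)\cup\xi$. -/
theorem glauberOp_congr (hd : 1 ≤ d) (ϰ : ℝ) (C G : Pt d → ℝ) {k k' : FinConf d → ℝ}
    (hk : k =ᵐ[lebesguePoisson d] k') :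
    glauberOp ϰ C G k =ᵐ[lebesguePoisson d] glauberOp ϰ C G k' := by
  filter_upwards [hk, ae_erase_union hd hk] with η hη hη'
  rw [glauberOp, glauberOp, hη]
  congr 2
  refine Finset.sum_congr rfl fun x hx => ?_
  congr 1
  refine integral_congr_ae ?_
  filter_upwards [hη' x hx] with ξ hξ
  rw [hξ]

theorem measurable_glauberOp (hd : 1 ≤ d) (ϰ : ℝ) {C G : Pt d → ℝ} (hC : Measurable C)
    (hG : Measurable G) {k : FinConf d → ℝ} (hk : Measurable k) :
    Measurable (glauberOp ϰ C G k) := by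
  have hcard : Measurable fun η : FinConf d => -(η.card : ℝ) * k η :=
    ((measurable_from_nat (f := fun n : ℕ => -(n : ℝ))).comp measurable_card).mul hk
  refine hcard.add (measurable_const.mul (measurable_iff_forall_conf.2 fun n => ?_))
  rcases n with _ | n
  · have : (fun x : DistinctTuples d 0 => ∑ y ∈ (conf 0 x.1).points,
        lpExp (fun z => C (y - z)) ((conf 0 x.1).erase y) *
        ∫ ξ, lpExp (fun z => G (y - z)) ξ * k (((conf 0 x.1).erase y).union ξ)
          ∂(lebesguePoisson d)) = fun _ => 0 := by
      funext x
      rw [sum_conf x.2]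
      simp
    rw [this]
    exact measurable_const
  · have : (fun x : DistinctTuples d (n + 1) => ∑ y ∈ (conf (n + 1) x.1).points,
        lpExp (fun z => C (y - z)) ((conf (n + 1) x.1).erase y) *
        ∫ ξ, lpExp (fun z => G (y - z)) ξ * k (((conf (n + 1) x.1).erase y).union ξ)
          ∂(lebesguePoisson d)) = fun x => ∑ i, (∏ j, C (x.1 i - x.1 (i.succAbove j))) *
        ∫ ξ, lpExp (fun z => G (x.1 i - z)) ξ * k ((conf n fun j => x.1 (i.succAbove j)).union ξ)
          ∂(lebesguePoisson d) := by
      funext x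
      rw [sum_conf x.2]
      refine Finset.sum_congr rfl fun i _ => ?_
      rw [conf_erase x.2, lpExp_conf fun j j' h => Fin.succAbove_right_injective (x.2 h)]
    rw [this]
    have hev : ∀ i, Measurable fun x : DistinctTuples d (n + 1) => x.1 i := fun i =>
      (measurable_pi_apply i).comp measurable_subtype_coe
    refine Finset.measurable_sum _ fun i _ => ?_
    refine (Finset.measurable_prod _ fun j _ => hC.comp ((hev i).sub (hev _))).mul ?_
    exact (measurable_integral_lpExp_mul hd hG hk n).comp
      ((hev i).prodMk (measurable_pi_lambda _ fun j => hev _))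

/-! ### Bounds in the spaces `K_α` -/

/-- The bound `|k(η)| ≤ N exp(-a |η|)`, almost everywhere. -/
def ExpBounded (a N : ℝ) (k : FinConf d → ℝ) : Prop :=
  ∀ᵐ η ∂(lebesguePoisson d), |k η| ≤ N * Real.exp (-a * (η.card : ℝ))

/-- Almost surely $|\zeta\cup\xi|=|\zeta|+|\xi|$, so $e^{-a|\xi|}$ merges with the kernel, whose
integral is then $\exp(e^{-a}\int f)$. The general `H` covers both $e(G)$ and a difference of two
such exponents. -/
theorem integrable_mul_union (hd : 1 ≤ d) {k : FinConf d → ℝ} (hk : Measurable k) {a N : ℝ}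
    {f : Pt d → ℝ} (hf : Measurable f) (hf0 : ∀ x, 0 ≤ f x) (hfi : Integrable f)
    {H : FinConf d → ℝ} (hH : Measurable H) {c : ℝ} {x : Pt d}
    (hHb : ∀ ξ, |H ξ| ≤ c * lpExp (fun y => f (x - y)) ξ) {ζ : FinConf d}
    (hζ : ∀ᵐ ξ ∂(lebesguePoisson d),
      |k (ζ.union ξ)| ≤ N * Real.exp (-a * ((ζ.union ξ).card : ℝ))) :
    Integrable (fun ξ => H ξ * k (ζ.union ξ)) (lebesguePoisson d) ∧
      |∫ ξ, H ξ * k (ζ.union ξ) ∂(lebesguePoisson d)| ≤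
        c * N * Real.exp (-a * (ζ.card : ℝ)) * Real.exp ((∫ x, f x) * Real.exp (-a)) := by
  have hg : Measurable fun y => Real.exp (-a) * f (x - y) :=
    measurable_const.mul (hf.comp (measurable_const.sub measurable_id))
  have hg0 : ∀ y, 0 ≤ Real.exp (-a) * f (x - y) := fun y =>
    mul_nonneg (Real.exp_pos _).le (hf0 _)
  have hgi : Integrable fun y => Real.exp (-a) * f (x - y) := (hfi.comp_sub_left x).const_mul _
  have hint := integral_lpExp hd hg hg0 hgi
  rw [integral_const_mul, integral_sub_left_eq_self f volume x, mul_comm (Real.exp (-a))] at hint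
  have hdom : ∀ᵐ ξ ∂(lebesguePoisson d), ‖H ξ * k (ζ.union ξ)‖ ≤
      c * N * Real.exp (-a * (ζ.card : ℝ)) * lpExp (fun y => Real.exp (-a) * f (x - y)) ξ := by
    filter_upwards [hζ, ae_card_union hd ζ] with ξ h1 h2
    rw [Real.norm_eq_abs, abs_mul]
    calc |H ξ| * |k (ζ.union ξ)| ≤ (c * lpExp (fun y => f (x - y)) ξ) *
          (N * Real.exp (-a * ((ζ.union ξ).card : ℝ))) :=
          mul_le_mul (hHb ξ) h1 (abs_nonneg _) ((abs_nonneg _).trans (hHb ξ))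
      _ = _ := by
          rw [h2, lpExp_const_mul, ← Real.exp_nat_mul]
          push_cast
          rw [mul_add, Real.exp_add, mul_comm (ξ.card : ℝ) (-a)]
          ring
  have hdi := (integrable_lpExp hd hg hg0 hgi).const_mul
    (c * N * Real.exp (-a * (ζ.card : ℝ)))
  refine ⟨hdi.mono' (hH.mul (hk.comp (measurable_union ζ))).aestronglyMeasurable hdom, ?_⟩
  refine (norm_integral_le_of_norm_le hdi hdom).trans ?_
  rw [integral_const_mul, hint]

/-- The kernels `C`, `G` of `glauberOp` are measurable, `0 ≤ C ≤ 1` and `|G| ≤ φ`. -/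
structure IsKernel (φ C G : Pt d → ℝ) : Prop where
  measurable_left : Measurable C
  measurable_right : Measurable G
  nonneg : ∀ x, 0 ≤ C x
  le_one : ∀ x, C x ≤ 1
  abs_le : ∀ x, |G x| ≤ φ x

namespace IsKernel

variable {φ C G C' G' : Pt d → ℝ}

theorem abs_lpExp_right_le (h : IsKernel φ C G) (x : Pt d) (ξ : FinConf d) :
    |lpExp (fun y => G (x - y)) ξ| ≤ 1 * lpExp (fun y => φ (x - y)) ξ := by
  rw [one_mul, lpExp, Finset.abs_prod]
  exact Finset.prod_le_prod (fun _ _ => abs_nonneg _) fun _ _ => h.abs_le _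

theorem abs_lpExp_left_le (h : IsKernel φ C G) (x : Pt d) (ξ : FinConf d) :
    |lpExp (fun y => C (x - y)) ξ| ≤ 1 := by
  rw [lpExp, Finset.abs_prod]
  exact Finset.prod_le_one (fun _ _ => abs_nonneg _) fun _ _ => by
    rw [abs_of_nonneg (h.nonneg _)]; exact h.le_one _

theorem measurable_lpExp_right (h : IsKernel φ C G) (x : Pt d) :
    Measurable (lpExp fun y => G (x - y)) :=
  measurable_lpExp (h.measurable_right.comp (measurable_const.sub measurable_id))

end IsKernel

theorem exp_neg_card_erase {η : FinConf d} {x : Pt d} (hx : x ∈ η.points) (a : ℝ) :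
    Real.exp (-a * ((η.erase x).card : ℝ)) = Real.exp a * Real.exp (-a * (η.card : ℝ)) := by
  rw [← card_erase_add_one hx, ← Real.exp_add]
  push_cast
  ring_nf

/-- This is $u\le e^{u-1}$ at $u=\delta y$. -/
theorem mul_exp_neg_mul_le {δ : ℝ} (hδ : 0 < δ) (y : ℝ) :
    y * Real.exp (-(δ * y)) ≤ 1 / (Real.exp 1 * δ) := by
  have h := Real.add_one_le_exp (δ * y - 1)
  rw [Real.exp_sub, sub_add_cancel, le_div_iff₀ (Real.exp_pos 1)] at h
  rw [le_div_iff₀ (by positivity), Real.exp_neg]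
  calc y * (Real.exp (δ * y))⁻¹ * (Real.exp 1 * δ)
      = δ * y * Real.exp 1 * (Real.exp (δ * y))⁻¹ := by ring
    _ ≤ Real.exp (δ * y) * (Real.exp (δ * y))⁻¹ := by gcongr
    _ = 1 := mul_inv_cancel₀ (Real.exp_pos _).ne'

section Bounds

variable {φ C G C' G' : Pt d → ℝ} {ϰ : ℝ} {k l : FinConf d → ℝ} {a b N : ℝ}

/-- Deleting a point yields the factor $e^a$, and the death term and the sum over $x$ each yield
$|\eta|$, which the surplus decay $e^{-(a-b)|\eta|}$ absorbs. -/
theorem IsKernel.expBounded_glauberOp (hd : 1 ≤ d) (hϰ : 0 ≤ ϰ) (h : IsKernel φ C G)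
    (hφ : Measurable φ) (hφ0 : ∀ x, 0 ≤ φ x) (hφi : Integrable φ) (hk : Measurable k)
    (hN : 0 ≤ N) (hkN : ExpBounded a N k) (hba : b < a) {M : ℝ}
    (hM : 1 + ϰ * Real.exp (a + (∫ x, φ x) * Real.exp (-a)) ≤ M) :
    ExpBounded b (M / (Real.exp 1 * (a - b)) * N) (glauberOp ϰ C G k) := by
  filter_upwards [hkN, ae_erase_union hd hkN] with η h1 h2
  set E := Real.exp ((∫ x, φ x) * Real.exp (-a)) with hE
  set e := Real.exp (-a * (η.card : ℝ)) with he
  have hterm : ∀ x ∈ η.points, |lpExp (fun y => C (x - y)) (η.erase x) *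
      ∫ ξ, lpExp (fun y => G (x - y)) ξ * k ((η.erase x).union ξ) ∂(lebesguePoisson d)| ≤
      N * (Real.exp a * e) * E := by
    intro x hx
    have h3 := (integrable_mul_union hd hk hφ hφ0 hφi (h.measurable_lpExp_right x)
      (h.abs_lpExp_right_le x) (h2 x hx)).2
    rw [exp_neg_card_erase hx, one_mul] at h3
    rw [abs_mul]
    calc _ ≤ 1 * |∫ ξ, lpExp (fun y => G (x - y)) ξ * k ((η.erase x).union ξ)
          ∂(lebesguePoisson d)| := by
          gcongr
          exact h.abs_lpExp_left_le x _
      _ ≤ _ := by rw [one_mul]; exact h3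
  have hsum := (Finset.abs_sum_le_sum_abs _ _).trans (Finset.sum_le_sum hterm)
  rw [Finset.sum_const, nsmul_eq_mul] at hsum
  have hM' : 1 + ϰ * (Real.exp a * E) ≤ M := by rwa [hE, ← Real.exp_add]
  calc |glauberOp ϰ C G k η| ≤ (η.card : ℝ) * (N * e) +
        ϰ * (η.card * (N * (Real.exp a * e) * E)) := by
        rw [glauberOp]
        refine (abs_add_le _ _).trans (add_le_add ?_ ?_)
        · rw [abs_mul, abs_neg, Nat.abs_cast]
          gcongr
        · rw [abs_mul, abs_of_nonneg hϰ]
          gcongr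
          exact hsum
    _ = (1 + ϰ * (Real.exp a * E)) * N * ((η.card : ℝ) * Real.exp (-((a - b) * (η.card : ℝ)))) *
          Real.exp (-b * (η.card : ℝ)) := by
        have : e = Real.exp (-((a - b) * (η.card : ℝ))) * Real.exp (-b * (η.card : ℝ)) := by
          rw [he, ← Real.exp_add]; ring_nf
        rw [this]; ring
    _ ≤ M * N * (1 / (Real.exp 1 * (a - b))) * Real.exp (-b * (η.card : ℝ)) := by
        have hM0 : 0 ≤ M := le_trans (by positivity) hM'
        gcongr
        exact mul_exp_neg_mul_le (sub_pos.2 hba) _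
    _ = _ := by ring

/-- Additivity holds only almost everywhere, where the bounds make both integrals converge. -/
theorem IsKernel.glauberOp_add (hd : 1 ≤ d) (h : IsKernel φ C G)
    (hφ : Measurable φ) (hφ0 : ∀ x, 0 ≤ φ x) (hφi : Integrable φ) (hk : Measurable k)
    (hl : Measurable l) {N' : ℝ} (hkN : ExpBounded a N k) (hlN : ExpBounded a N' l) :
    ∀ᵐ η ∂(lebesguePoisson d),
      glauberOp ϰ C G (fun η => k η + l η) η = glauberOp ϰ C G k η + glauberOp ϰ C G l η := by
  filter_upwards [ae_erase_union hd hkN, ae_erase_union hd hlN] with η h1 h2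
  have hterm : ∀ x ∈ η.points,
      ∫ ξ, lpExp (fun y => G (x - y)) ξ * (k ((η.erase x).union ξ) + l ((η.erase x).union ξ))
        ∂(lebesguePoisson d) =
      ∫ ξ, lpExp (fun y => G (x - y)) ξ * k ((η.erase x).union ξ) ∂(lebesguePoisson d) +
      ∫ ξ, lpExp (fun y => G (x - y)) ξ * l ((η.erase x).union ξ) ∂(lebesguePoisson d) := by
    intro x hx
    rw [← integral_add (integrable_mul_union hd hk hφ hφ0 hφi (h.measurable_lpExp_right x)
      (h.abs_lpExp_right_le x) (h1 x hx)).1 (integrable_mul_union hd hl hφ hφ0 hφi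
      (h.measurable_lpExp_right x) (h.abs_lpExp_right_le x) (h2 x hx)).1]
    simp only [mul_add]
  simp only [glauberOp]
  rw [Finset.sum_congr rfl fun x hx => by rw [hterm x hx, mul_add], Finset.sum_add_distrib]
  ring

theorem glauberOp_const_mul (c : ℝ) (k : FinConf d → ℝ) (η : FinConf d) :
    glauberOp ϰ C G (fun η => c * k η) η = c * glauberOp ϰ C G k η := by
  simp only [glauberOp, mul_left_comm _ c, integral_const_mul, ← Finset.mul_sum]
  ring

theorem abs_prod_sub_prod_le {ι : Type*} (s : Finset ι) {f g u : ι → ℝ} {δ : ℝ} (hδ : 0 ≤ δ)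
    (hf : ∀ i, |f i| ≤ u i) (hg : ∀ i, |g i| ≤ u i) (hfg : ∀ i, |f i - g i| ≤ δ * u i) :
    |∏ i ∈ s, f i - ∏ i ∈ s, g i| ≤ s.card * δ * ∏ i ∈ s, u i := by
  classical
  have hu : ∀ i, 0 ≤ u i := fun i => (abs_nonneg _).trans (hf i)
  induction s using Finset.induction_on with
  | empty => simp
  | insert j s hj ih =>
    rw [Finset.prod_insert hj, Finset.prod_insert hj, Finset.prod_insert hj,
      Finset.card_insert_of_notMem hj]
    have hP : |∏ i ∈ s, f i| ≤ ∏ i ∈ s, u i := by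
      rw [Finset.abs_prod]
      exact Finset.prod_le_prod (fun _ _ => abs_nonneg _) fun i _ => hf i
    calc |f j * ∏ i ∈ s, f i - g j * ∏ i ∈ s, g i|
        = |(f j - g j) * ∏ i ∈ s, f i + g j * (∏ i ∈ s, f i - ∏ i ∈ s, g i)| := by ring_nf
      _ ≤ |f j - g j| * |∏ i ∈ s, f i| + |g j| * |∏ i ∈ s, f i - ∏ i ∈ s, g i| := by
          rw [← abs_mul, ← abs_mul]; exact abs_add_le _ _
      _ ≤ δ * u j * ∏ i ∈ s, u i + u j * (s.card * δ * ∏ i ∈ s, u i) := by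
          have := hu j
          gcongr
          · exact hfg j
          · exact hg j
      _ = _ := by push_cast; ring

/-- Telescoping the product costs $|\xi|\le2^{|\xi|}$, absorbed by doubling $\phi$. -/
theorem IsKernel.abs_lpExp_right_sub_le (h : IsKernel φ C G) (h' : IsKernel φ C' G')
    (hφ0 : ∀ x, 0 ≤ φ x) {δ : ℝ} (hδ : 0 ≤ δ) (hG : ∀ x, |G x - G' x| ≤ δ * φ x) (x : Pt d)
    (ξ : FinConf d) : |lpExp (fun y => G (x - y)) ξ - lpExp (fun y => G' (x - y)) ξ| ≤
      δ * lpExp (fun y => 2 * φ (x - y)) ξ := by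
  refine (abs_prod_sub_prod_le ξ.points hδ (fun y => h.abs_le (x - y))
    (fun y => h'.abs_le (x - y)) (fun y => hG (x - y))).trans ?_
  rw [lpExp_const_mul]
  have h1 : ((ξ.points.card : ℕ) : ℝ) ≤ 2 ^ ξ.card := by
    exact_mod_cast (Nat.lt_two_pow_self (n := ξ.card)).le
  have h2 : 0 ≤ ∏ y ∈ ξ.points, φ (x - y) := Finset.prod_nonneg fun _ _ => hφ0 _
  calc _ ≤ 2 ^ ξ.card * δ * ∏ y ∈ ξ.points, φ (x - y) := by gcongr
    _ = _ := by rw [lpExp]; ring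

theorem IsKernel.abs_lpExp_left_sub_le (h : IsKernel φ C G) (h' : IsKernel φ C' G')
    {δ : ℝ} (hδ : 0 ≤ δ) (hC : ∀ x, |C x - C' x| ≤ δ) (x : Pt d) (ξ : FinConf d) :
    |lpExp (fun y => C (x - y)) ξ - lpExp (fun y => C' (x - y)) ξ| ≤ ξ.card * δ := by
  have := abs_prod_sub_prod_le ξ.points (u := fun _ => 1) hδ
    (fun y => (abs_of_nonneg (h.nonneg (x - y))).trans_le (h.le_one (x - y)))
    (fun y => (abs_of_nonneg (h'.nonneg (x - y))).trans_le (h'.le_one (x - y)))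
    (fun y => by rw [mul_one]; exact hC (x - y))
  simpa [lpExp, FinConf.card] using this

theorem IsKernel.expBounded_glauberOp_sub (hd : 1 ≤ d) (hϰ : 0 ≤ ϰ) (h : IsKernel φ C G)
    (h' : IsKernel φ C' G') (hφ : Measurable φ) (hφ0 : ∀ x, 0 ≤ φ x) (hφi : Integrable φ)
    {δ : ℝ} (hδ : 0 ≤ δ) (hC : ∀ x, |C x - C' x| ≤ δ) (hG : ∀ x, |G x - G' x| ≤ δ * φ x)
    (hk : Measurable k) (hN : 0 ≤ N) (hkN : ExpBounded a N k) (hba : b < a) :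
    ExpBounded b (δ * (ϰ * N * Real.exp (a + (∫ x, 2 * φ x) * Real.exp (-a)) *
        (2 * (1 / (Real.exp 1 * ((a - b) / 2))) ^ 2)))
      (fun η => glauberOp ϰ C G k η - glauberOp ϰ C' G' k η) := by
  filter_upwards [ae_erase_union hd hkN] with η h2
  set E := Real.exp ((∫ x, 2 * φ x) * Real.exp (-a)) with hE
  set e := Real.exp (-a * (η.card : ℝ)) with he
  have hEle : Real.exp ((∫ x, φ x) * Real.exp (-a)) ≤ E := by
    have : 0 ≤ ∫ x, φ x := integral_nonneg hφ0
    rw [hE, integral_const_mul]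
    gcongr
    linarith
  have hterm : ∀ x ∈ η.points,
      |lpExp (fun y => C (x - y)) (η.erase x) *
        ∫ ξ, lpExp (fun y => G (x - y)) ξ * k ((η.erase x).union ξ) ∂(lebesguePoisson d) -
      lpExp (fun y => C' (x - y)) (η.erase x) *
        ∫ ξ, lpExp (fun y => G' (x - y)) ξ * k ((η.erase x).union ξ) ∂(lebesguePoisson d)| ≤
      δ * N * (Real.exp a * e) * E * (1 + ((η.erase x).card : ℝ)) := by
    intro x hx
    obtain ⟨hi, -⟩ := integrable_mul_union hd hk hφ hφ0 hφi (h.measurable_lpExp_right x)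
      (h.abs_lpExp_right_le x) (h2 x hx)
    obtain ⟨hi', hb'⟩ := integrable_mul_union hd hk hφ hφ0 hφi (h'.measurable_lpExp_right x)
      (h'.abs_lpExp_right_le x) (h2 x hx)
    obtain ⟨-, hbd⟩ := integrable_mul_union hd hk (f := fun x => 2 * φ x)
      (measurable_const.mul hφ) (fun x => mul_nonneg zero_le_two (hφ0 x)) (hφi.const_mul 2)
      ((h.measurable_lpExp_right x).sub (h'.measurable_lpExp_right x))
      (h.abs_lpExp_right_sub_le h' hφ0 hδ hG x) (h2 x hx)
    simp only [Pi.sub_apply, sub_mul] at hbd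
    rw [integral_sub hi hi', exp_neg_card_erase hx] at hbd
    rw [exp_neg_card_erase hx, one_mul] at hb'
    set I := ∫ ξ, lpExp (fun y => G (x - y)) ξ * k ((η.erase x).union ξ) ∂(lebesguePoisson d)
    set I' := ∫ ξ, lpExp (fun y => G' (x - y)) ξ * k ((η.erase x).union ξ) ∂(lebesguePoisson d)
    calc _ = |lpExp (fun y => C (x - y)) (η.erase x) * (I - I') +
          (lpExp (fun y => C (x - y)) (η.erase x) - lpExp (fun y => C' (x - y)) (η.erase x)) * I'|
            := by ring_nf
      _ ≤ 1 * (δ * N * (Real.exp a * e) * E) +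
          ((η.erase x).card * δ) * (N * (Real.exp a * e) * E) := by
          refine (abs_add_le _ _).trans ?_
          rw [abs_mul, abs_mul]
          gcongr
          · exact h.abs_lpExp_left_le x _
          · exact h.abs_lpExp_left_sub_le h' hδ hC x _
          · exact hb'.trans (by gcongr)
      _ = _ := by ring
  have hterm' : ∀ x ∈ η.points, _ ≤ δ * N * (Real.exp a * e) * E * (2 * (η.card : ℝ)) :=
    fun x hx => (hterm x hx).trans (by
      have h1 := card_erase_add_one hx
      have h2 : ((η.erase x).card : ℝ) + 1 = η.card := by exact_mod_cast h1
      gcongr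
      have : (0 : ℝ) ≤ η.card := by positivity
      linarith)
  have hsum := (Finset.abs_sum_le_sum_abs _ _).trans (Finset.sum_le_sum hterm')
  rw [Finset.sum_const, nsmul_eq_mul, Finset.sum_sub_distrib] at hsum
  -- The difference grows like $|\eta|^2$, so the loss $a-b$ is halved and each half absorbs one
  -- factor $|\eta|$.
  have hy := mul_exp_neg_mul_le (half_pos (sub_pos.2 hba)) (η.card : ℝ)
  calc |glauberOp ϰ C G k η - glauberOp ϰ C' G' k η|
      ≤ ϰ * (η.card * (δ * N * (Real.exp a * e) * E * (2 * (η.card : ℝ)))) := by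
        rw [glauberOp, glauberOp, add_sub_add_left_eq_sub, ← mul_sub, abs_mul, abs_of_nonneg hϰ]
        gcongr
        exact hsum
    _ = δ * (ϰ * N * (Real.exp a * E) *
          (2 * ((η.card : ℝ) * Real.exp (-((a - b) / 2 * (η.card : ℝ)))) ^ 2)) *
          Real.exp (-b * (η.card : ℝ)) := by
        have : e = Real.exp (-((a - b) / 2 * (η.card : ℝ))) ^ 2 *
            Real.exp (-b * (η.card : ℝ)) := by
          rw [he, ← Real.exp_nat_mul, ← Real.exp_add]
          push_cast
          ring_nf
        rw [this]; ring
    _ ≤ _ := by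
        rw [Real.exp_add]
        gcongr

end Bounds

end GlauberVlasov

namespace GlauberVlasov

variable {d : ℕ} {a b : ℝ}

/-! ### The scale of the spaces `K_α` -/

theorem K.measurable_rep (k : K d a) : Measurable k.rep :=
  AEEqFun.measurable k.toClass

theorem K.expBounded_rep (k : K d a) : ExpBounded a ‖k‖ k.rep := by
  have h1 : ‖k‖ₑ = eLpNorm (fun η => weight a η * k.rep η) ⊤ (lebesguePoisson d) := by
    change ‖k.memLp.toLp _‖ₑ = _
    rw [Lp.enorm_toLp]
  have h2 := enorm_ae_le_eLpNormEssSup (fun η => weight a η * k.rep η) (lebesguePoisson d)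
  rw [← eLpNorm_exponent_top, ← h1] at h2
  filter_upwards [h2] with η hη
  have h3 : ‖weight a η * k.rep η‖ ≤ ‖k‖ := enorm_le_iff_norm_le.1 hη
  rw [norm_mul, weight, Real.norm_of_nonneg (Real.exp_pos _).le, Real.norm_eq_abs] at h3
  rw [neg_mul, Real.exp_neg, ← div_eq_mul_inv, le_div_iff₀ (Real.exp_pos _), mul_comm]
  exact h3

theorem K.norm_le {k : K d a} {N : ℝ} (hN : 0 ≤ N) (h : ExpBounded a N k.rep) : ‖k‖ ≤ N := by
  change ‖k.memLp.toLp _‖ ≤ N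
  rw [Lp.norm_toLp]
  refine ENNReal.toReal_le_of_le_ofReal hN ?_
  rw [eLpNorm_exponent_top]
  refine eLpNormEssSup_le_of_ae_bound ?_
  filter_upwards [h] with η hη
  rw [norm_mul, weight, Real.norm_of_nonneg (Real.exp_pos _).le, Real.norm_eq_abs]
  rwa [neg_mul, Real.exp_neg, ← div_eq_mul_inv, le_div_iff₀ (Real.exp_pos _), mul_comm] at hη

theorem measurable_weight : Measurable (weight a : FinConf d → ℝ) :=
  (measurable_from_nat (f := fun n : ℕ => Real.exp (a * (n : ℝ)))).comp measurable_card

/-- A class with a representative satisfying an exponential bound belongs to `K_a`. -/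
theorem exists_toClass_eq {N : ℝ} {v : FinConf d →ₘ[lebesguePoisson d] ℝ}
    (h : ExpBounded a N v) : ∃ k : K d a, k.toClass = v := by
  have hv : IsWeightedBounded a v := by
    refine memLp_top_of_bound (measurable_weight.aestronglyMeasurable.mul v.aestronglyMeasurable) N ?_
    filter_upwards [h] with η hη
    rw [norm_mul, weight, Real.norm_of_nonneg (Real.exp_pos _).le, Real.norm_eq_abs]
    rwa [neg_mul, Real.exp_neg, ← div_eq_mul_inv, le_div_iff₀ (Real.exp_pos _), mul_comm] at hη
  exact ⟨⟨v, hv⟩, rfl⟩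

theorem K.toLinfty_surjective : Function.Surjective (K.toLinfty d a) := by
  intro f
  have hm : Measurable fun η : FinConf d => weight (-a) η * f η :=
    measurable_weight.mul (Lp.stronglyMeasurable f).measurable
  have hw : ∀ η : FinConf d, weight a η * weight (-a) η = 1 := fun η => by
    rw [weight, weight, ← Real.exp_add]; simp
  have hm' : AEStronglyMeasurable (fun η => weight (-a) η * f η) (lebesguePoisson d) :=
    hm.aestronglyMeasurable
  have hv : (fun η => weight a η * AEEqFun.mk _ hm' η)
      =ᵐ[lebesguePoisson d] f := by
    filter_upwards [AEEqFun.coeFn_mk _ hm'] with η hη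
    rw [hη, ← mul_assoc, hw, one_mul]
  have hmem : IsWeightedBounded a (AEEqFun.mk _ hm') :=
    (memLp_congr_ae hv).2 (Lp.memLp f)
  refine ⟨⟨_, hmem⟩, Lp.ext ?_⟩
  exact (MemLp.coeFn_toLp hmem).trans hv

instance (a : ℝ) : CompleteSpace (K d a) := by
  let e : K d a ≃ₗᵢ[ℝ] Lp ℝ ⊤ (lebesguePoisson d) :=
    { LinearEquiv.ofBijective (K.toLinfty d a)
        ⟨K.toLinfty_injective d a, K.toLinfty_surjective⟩ with
      norm_map' := fun _ => rfl }
  exact e.toIsometryEquiv.completeSpace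

theorem ExpBounded.mono {N : ℝ} (hN : 0 ≤ N) (hba : b ≤ a) {k : FinConf d → ℝ}
    (h : ExpBounded a N k) : ExpBounded b N k := by
  filter_upwards [h] with η hη
  exact hη.trans (by gcongr)

theorem K.toClass_injective : Function.Injective (K.toClass : K d a → _) := Subtype.val_injective

theorem K.exists_incl (hba : b ≤ a) (k : K d a) : ∃ l : K d b, l.toClass = k.toClass :=
  exists_toClass_eq (k.expBounded_rep.mono (norm_nonneg k) hba)

theorem K.norm_le_of_toClass_eq (hba : b ≤ a) {k : K d a} {l : K d b}
    (h : l.toClass = k.toClass) : ‖l‖ ≤ ‖k‖ := by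
  refine K.norm_le (norm_nonneg k) ?_
  have := k.expBounded_rep.mono (norm_nonneg k) hba
  rwa [K.rep, ← h] at this

/-- The inclusion of `K_a` into the space of all classes of measurable functions. -/
def K.toClassₗ (d : ℕ) (a : ℝ) : K d a →ₗ[ℝ] (FinConf d →ₘ[lebesguePoisson d] ℝ) :=
  (kSubmodule d a).subtype

/-- A linear map into `K_b` from a map into the space of classes which respects the bounds. -/
theorem exists_continuousLinearMap {E : Type*} [NormedAddCommGroup E] [NormedSpace ℝ E]
    (f : E →ₗ[ℝ] (FinConf d →ₘ[lebesguePoisson d] ℝ)) (c : ℝ)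
    (hf : ∀ x, ∃ l : K d b, l.toClass = f x ∧ ‖l‖ ≤ c * ‖x‖) :
    ∃ L : E →L[ℝ] K d b, (∀ x, (L x).toClass = f x) ∧ ∀ x, ‖L x‖ ≤ c * ‖x‖ := by
  choose g hg hgn using hf
  let L : E →ₗ[ℝ] K d b :=
    { toFun := g
      map_add' := fun x y => K.toClass_injective (by
        change (g (x + y)).toClass = (g x).toClass + (g y).toClass
        rw [hg, hg, hg, map_add])
      map_smul' := fun r x => K.toClass_injective (by
        change (g (r • x)).toClass = r • (g x).toClass
        rw [hg, hg, map_smul]) }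
  exact ⟨L.mkContinuous c hgn, hg, hgn⟩

/-- The spaces `K_a` as a scale inside the space of all classes of measurable functions. -/
def kScale (d : ℕ) : NormedScale (K d) (FinConf d →ₘ[lebesguePoisson d] ℝ) :=
  have h : ∀ {a b : ℝ}, b ≤ a → ∃ L : K d a →L[ℝ] K d b,
      (∀ x, (L x).toClass = K.toClassₗ d a x) ∧ ∀ x, ‖L x‖ ≤ 1 * ‖x‖ := fun {a b} hba =>
    exists_continuousLinearMap (K.toClassₗ d a) 1 fun x => by
      obtain ⟨l, hl⟩ := K.exists_incl hba x
      exact ⟨l, hl, by rw [one_mul]; exact K.norm_le_of_toClass_eq hba hl⟩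
  { toV := K.toClassₗ d
    toV_injective := fun _ => K.toClass_injective
    incl := fun hba => (h hba).choose
    toV_incl := fun hba x => (h hba).choose_spec.1 x
    norm_incl_le := fun hba x => by simpa using (h hba).choose_spec.2 x }

/-! ### The generators on classes -/

/-- The action of `glauberOp` on classes of measurable functions. -/
def glauberClass (ϰ : ℝ) (C G : Pt d → ℝ)
    (v : FinConf d →ₘ[lebesguePoisson d] ℝ) : FinConf d →ₘ[lebesguePoisson d] ℝ := by
  classical
  -- The default `0` is never taken for an `IsKernel` pair, since `glauberOp` then preserves
  -- measurability.
  exact if h : AEStronglyMeasurable (glauberOp ϰ C G v) (lebesguePoisson d) then AEEqFun.mk _ h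
    else 0

variable {φ C G C' G' : Pt d → ℝ} {ϰ : ℝ}

theorem IsKernel.coeFn_glauberClass (hd : 1 ≤ d) (h : IsKernel φ C G)
    (v : FinConf d →ₘ[lebesguePoisson d] ℝ) :
    glauberClass ϰ C G v =ᵐ[lebesguePoisson d] glauberOp ϰ C G v := by
  have hm : AEStronglyMeasurable (glauberOp ϰ C G v) (lebesguePoisson d) :=
    (measurable_glauberOp hd ϰ h.measurable_left h.measurable_right
      (AEEqFun.measurable v)).aestronglyMeasurable
  rw [glauberClass, dif_pos hm]
  exact AEEqFun.coeFn_mk _ hm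

/-- The constant takes the worst case of $a$ in each place: $a\le hi$ in the first term of the
exponent and $a\ge lo$ in $e^{-a}$. For `lo = α`, `hi = α₀` it is the denominator of `timeBound`. -/
theorem IsKernel.isSingular (hd : 1 ≤ d) (hϰ : 0 ≤ ϰ) (h : IsKernel φ C G)
    (hφ : Measurable φ) (hφ0 : ∀ x, 0 ≤ φ x) (hφi : Integrable φ) (lo hi : ℝ) :
    (kScale d).IsSingular (glauberClass ϰ C G)
      (1 + ϰ * Real.exp (hi + (∫ x, φ x) * Real.exp (-lo))) lo hi := by
  intro a b hlo hba hhi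
  set M := 1 + ϰ * Real.exp (hi + (∫ x, φ x) * Real.exp (-lo)) with hM
  have hM' : 1 + ϰ * Real.exp (a + (∫ x, φ x) * Real.exp (-a)) ≤ M := by
    have : 0 ≤ ∫ x, φ x := integral_nonneg hφ0
    rw [hM]
    gcongr
    linarith
  have hM0 : 0 ≤ M / (Real.exp 1 * (a - b)) := by
    have := sub_pos.2 hba
    positivity
  have hae := fun v => h.coeFn_glauberClass (ϰ := ϰ) hd v
  let f : K d a →ₗ[ℝ] (FinConf d →ₘ[lebesguePoisson d] ℝ) :=
    { toFun := fun x => glauberClass ϰ C G x.toClass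
      map_add' := fun x y => by
        refine AEEqFun.ext ?_
        have h1 := glauberOp_congr hd ϰ C G (AEEqFun.coeFn_add x.toClass y.toClass)
        filter_upwards [hae (x + y).toClass, hae x.toClass, hae y.toClass, h1,
          AEEqFun.coeFn_add (glauberClass ϰ C G x.toClass) (glauberClass ϰ C G y.toClass),
          h.glauberOp_add (ϰ := ϰ) hd hφ hφ0 hφi x.measurable_rep y.measurable_rep
            x.expBounded_rep y.expBounded_rep] with η e1 e2 e3 e4 e5 e6
        rw [e1, e5, Pi.add_apply, e2, e3]
        exact e4.trans e6
      map_smul' := fun c x => by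
        refine AEEqFun.ext ?_
        have h1 := glauberOp_congr hd ϰ C G (AEEqFun.coeFn_smul c x.toClass)
        filter_upwards [hae (c • x).toClass, hae x.toClass, h1,
          AEEqFun.coeFn_smul c (glauberClass ϰ C G x.toClass)] with η e1 e2 e4 e5
        rw [RingHom.id_apply, e1, e5, Pi.smul_apply, e2, smul_eq_mul]
        exact e4.trans (glauberOp_const_mul c _ η) }
  refine exists_continuousLinearMap f _ fun x => ?_
  have hb : ExpBounded b (M / (Real.exp 1 * (a - b)) * ‖x‖) (glauberClass ϰ C G x.toClass) := by
    filter_upwards [hae x.toClass, h.expBounded_glauberOp hd hϰ hφ hφ0 hφi x.measurable_rep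
      (norm_nonneg x) x.expBounded_rep hba hM'] with η h1 h2
    rw [h1]; exact h2
  obtain ⟨l, hl⟩ := exists_toClass_eq hb
  refine ⟨l, hl, K.norm_le (by positivity) ?_⟩
  rw [K.rep, hl]; exact hb

/-- Strong convergence of the generators when the kernels converge uniformly. -/
theorem tendsto_of_glauberClass (hd : 1 ≤ d) (hϰ : 0 ≤ ϰ) (h : IsKernel φ C G)
    (hφ : Measurable φ) (hφ0 : ∀ x, 0 ≤ φ x) (hφi : Integrable φ) {ι : Type*} {l : Filter ι}
    {Cε Gε : ι → Pt d → ℝ} {δ : ι → ℝ} (hδ : Tendsto δ l (𝓝 0))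
    (hε : ∀ᶠ i in l, IsKernel φ (Cε i) (Gε i) ∧ 0 ≤ δ i ∧ (∀ x, |Cε i x - C x| ≤ δ i) ∧
      ∀ x, |Gε i x - G x| ≤ δ i * φ x) (hba : b < a) (x : K d a) (y : K d b)
    (hy : y.toClass = glauberClass ϰ C G x.toClass) (z : ι → K d b)
    (hz : ∀ᶠ i in l, (z i).toClass = glauberClass ϰ (Cε i) (Gε i) x.toClass) :
    Tendsto z l (𝓝 y) := by
  set c := ϰ * ‖x‖ * Real.exp (a + (∫ x, 2 * φ x) * Real.exp (-a)) *
    (2 * (1 / (Real.exp 1 * ((a - b) / 2))) ^ 2) with hc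
  have hlim : Tendsto (fun i => δ i * c) l (𝓝 0) := by simpa using hδ.mul_const c
  refine tendsto_iff_norm_sub_tendsto_zero.2
    (squeeze_zero' (Eventually.of_forall fun _ => norm_nonneg _) ?_ hlim)
  filter_upwards [hε, hz] with i ⟨hi, hδi, hCi, hGi⟩ hzi
  refine K.norm_le (by positivity) ?_
  filter_upwards [AEEqFun.coeFn_sub (z i).toClass y.toClass,
    hi.coeFn_glauberClass (ϰ := ϰ) hd x.toClass, h.coeFn_glauberClass (ϰ := ϰ) hd x.toClass,
    hi.expBounded_glauberOp_sub hd hϰ h hφ hφ0 hφi hδi hCi hGi x.measurable_rep (norm_nonneg x)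
      x.expBounded_rep hba] with η e1 e2 e3 e4
  have : (z i - y).rep η = glauberOp ϰ (Cε i) (Gε i) x.toClass η -
      glauberOp ϰ C G x.toClass η := by
    refine e1.trans ?_
    rw [Pi.sub_apply, hzi, hy, e2, e3]
  rw [this]
  exact e4

theorem IsKernel.isClassicalSolution_iff (hd : 1 ≤ d) (h : IsKernel φ C G)
    {A : (FinConf d → ℝ) → FinConf d → ℝ}
    (hA : ∀ k, A k =ᵐ[lebesguePoisson d] glauberOp ϰ C G k)
    {v : FinConf d →ₘ[lebesguePoisson d] ℝ} {T : ℝ} {u : ℝ → K d a} :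
    IsClassicalSolution A v T u ↔ (kScale d).IsSolution (glauberClass ϰ C G) v T u := by
  have heq : ∀ t, (deriv u t).rep =ᵐ[lebesguePoisson d] A (u t).rep ↔
      (deriv u t).toClass = glauberClass ϰ C G (u t).toClass := by
    intro t
    have h1 : A (u t).rep =ᵐ[lebesguePoisson d] glauberClass ϰ C G (u t).toClass :=
      (hA _).trans (h.coeFn_glauberClass hd _).symm
    exact ⟨fun h2 => AEEqFun.ext (h2.trans h1), fun h2 => by
      refine EventuallyEq.trans ?_ h1.symm
      rw [K.rep, h2]⟩
  exact ⟨fun hu => ⟨hu.1, hu.2, hu.3, fun t ht => (heq t).1 (hu.4 t ht), hu.5⟩,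
    fun hu => ⟨hu.1, hu.2, hu.3, fun t ht => (heq t).2 (hu.4 t ht), hu.5⟩⟩

theorem IsKernel.exists_unique_isSolution (hd : 1 ≤ d) (hϰ : 0 ≤ ϰ) (h : IsKernel φ C G)
    (hφ : Measurable φ) (hφ0 : ∀ x, 0 ≤ φ x) (hφi : Integrable φ) {α₀ α : ℝ} (hα : α < α₀)
    (r : K d α₀) : ∃ u : ℝ → K d α,
      (kScale d).IsSolution (glauberClass ϰ C G) r.toClass (timeBound ϰ φ α₀ α) u ∧
      ∀ u' : ℝ → K d α,
        (kScale d).IsSolution (glauberClass ϰ C G) r.toClass (timeBound ϰ φ α₀ α) u' →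
        EqOn u' u (Ico 0 (timeBound ϰ φ α₀ α)) := by
  have hs := h.isSingular hd hϰ hφ hφ0 hφi α α₀
  obtain ⟨c, hc, -⟩ := hs.exists_coeff (by positivity) hα r
  have hu := hs.isSolution_expSeries (by positivity) hα r c hc
  refine ⟨_, hu, fun u' hu' => ?_⟩
  -- Competing solutions are only known to lie in $\mathcal K_\alpha$, so uniqueness descends below
  -- $\alpha$; the endpoint `α - 1` is arbitrary.
  exact NormedScale.IsSolution.eqOn (h.isSingular hd hϰ hφ hφ0 hφi (α - 1) α) (by positivity)
    (sub_one_lt α) hu' hu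

/-! ### The kernels of the rescaled dynamics and of the Vlasov hierarchy -/

theorem exp_neg_bounds {u : ℝ} (hu : 0 ≤ u) :
    0 ≤ Real.exp (-u) - 1 + u ∧ Real.exp (-u) - 1 + u ≤ u ^ 2 := by
  refine ⟨by linarith [Real.add_one_le_exp (-u)], ?_⟩
  -- From $e^{-u}\le1/(1+u)$ follows $e^{-u}-1+u\le u^2/(1+u)\le u^2$.
  have h1 : Real.exp (-u) * (1 + u) ≤ 1 := by
    calc Real.exp (-u) * (1 + u) ≤ Real.exp (-u) * Real.exp u := by
          gcongr; linarith [Real.add_one_le_exp u]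
      _ = 1 := by rw [← Real.exp_add]; simp
  nlinarith [Real.exp_pos (-u), mul_nonneg (sq_nonneg u) hu]

theorem isKernel_vlasov (hφ : Measurable φ) (hφ0 : ∀ x, 0 ≤ φ x) :
    IsKernel φ (fun _ => 1) fun x => -φ x :=
  ⟨measurable_const, hφ.neg, fun _ => zero_le_one, fun _ => le_rfl, fun x => by
    rw [abs_neg, abs_of_nonneg (hφ0 x)]⟩

theorem isKernel_rescaled (hφ : Measurable φ) (hφ0 : ∀ x, 0 ≤ φ x) {ε : ℝ} (hε : 0 < ε) :
    IsKernel φ (fun x => Real.exp (-(ε * φ x))) fun x => ε⁻¹ * (Real.exp (-(ε * φ x)) - 1) := by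
  have h0 : ∀ x, 0 ≤ ε * φ x := fun x => mul_nonneg hε.le (hφ0 x)
  have h1 : ∀ x, Real.exp (-(ε * φ x)) ≤ 1 := fun x => Real.exp_le_one_iff.2 (by linarith [h0 x])
  have hm : Measurable fun x => Real.exp (-(ε * φ x)) := (measurable_const.mul hφ).neg.exp
  refine ⟨hm, measurable_const.mul (hm.sub measurable_const), fun x => (Real.exp_pos _).le, h1,
    fun x => ?_⟩
  rw [abs_mul, abs_of_pos (inv_pos.2 hε), abs_of_nonpos (by linarith [h1 x]), inv_mul_le_iff₀ hε]
  linarith [(exp_neg_bounds (h0 x)).1]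

/-- Boundedness of $\phi$ turns the quadratic remainder $\varepsilon^{-1}(\varepsilon\phi)^2$ into
$\varepsilon D\phi$, a small multiple of the integrable kernel. -/
theorem abs_rescaled_sub_vlasov_le (hφ0 : ∀ x, 0 ≤ φ x) {D : ℝ} (hφD : ∀ x, φ x ≤ D) {ε : ℝ}
    (hε : 0 < ε) : (∀ x, |Real.exp (-(ε * φ x)) - 1| ≤ ε * D) ∧
      ∀ x, |ε⁻¹ * (Real.exp (-(ε * φ x)) - 1) - -φ x| ≤ ε * D * φ x := by
  have h0 : ∀ x, 0 ≤ ε * φ x := fun x => mul_nonneg hε.le (hφ0 x)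
  refine ⟨fun x => ?_, fun x => ?_⟩
  · have h1 : Real.exp (-(ε * φ x)) ≤ 1 := Real.exp_le_one_iff.2 (by linarith [h0 x])
    rw [abs_of_nonpos (by linarith)]
    have := mul_le_mul_of_nonneg_left (hφD x) hε.le
    linarith [(exp_neg_bounds (h0 x)).1]
  · obtain ⟨h1, h2⟩ := exp_neg_bounds (h0 x)
    have e : ε⁻¹ * (Real.exp (-(ε * φ x)) - 1) - -φ x =
        ε⁻¹ * (Real.exp (-(ε * φ x)) - 1 + ε * φ x) := by
      field_simp
      ring
    rw [e, abs_of_nonneg (by positivity), inv_mul_le_iff₀ hε]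
    calc _ ≤ (ε * φ x) ^ 2 := h2
      _ = ε * (ε * φ x * φ x) := by ring
      _ ≤ ε * (ε * D * φ x) := by
          have := hφ0 x
          gcongr
          exact hφD x

theorem exists_bounded_measurable_representative {φ : Pt d → ℝ} (h0 : ∀ x, 0 ≤ φ x)
    (hinf : MemLp φ ⊤ volume) : ∃ (ψ : Pt d → ℝ) (D : ℝ), Measurable ψ ∧ (∀ x, 0 ≤ ψ x) ∧
      (∀ x, ψ x ≤ D) ∧ φ =ᵐ[volume] ψ := by
  obtain ⟨g, hg, hφg⟩ := hinf.1
  set D := (eLpNorm φ ⊤ volume).toReal with hD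
  refine ⟨fun x => min (max (g x) 0) D, D, (hg.measurable.max measurable_const).min
    measurable_const, fun x => le_min (le_max_right _ _) ENNReal.toReal_nonneg,
    fun x => min_le_right _ _, ?_⟩
  have hb := enorm_ae_le_eLpNormEssSup φ volume
  filter_upwards [hφg, hb] with x h1 h2
  have h3 : φ x ≤ D := by
    rw [← eLpNorm_exponent_top] at h2
    have := ENNReal.toReal_mono hinf.2.ne h2
    rw [toReal_enorm, Real.norm_of_nonneg (h0 x)] at this
    exact this
  rw [← h1, max_eq_left (h0 x), min_eq_left h3]

end GlauberVlasov

end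

/-! ### The main theorem -/

open GlauberVlasov in
theorem theorem4p4 (d : ℕ) (hd : 1 ≤ d) (ϰ : ℝ) (hϰ : 0 < ϰ)
    (φ : EuclideanSpace ℝ (Fin d) → ℝ) (hφ_nonneg : ∀ x, 0 ≤ φ x)
    (hφ_even : ∀ x, φ (-x) = φ x) (hφ_L1 : MemLp φ 1 volume) (hφ_Linfty : MemLp φ ⊤ volume)
    (α₀ α : ℝ) (hα : α < α₀) (r₀ : K d α₀) :
    -- both Cauchy problems have unique classical solutions in `K_α`
    (∀ ε : ℝ, 0 < ε → ∃ k : ℝ → K d α,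
      IsClassicalSolution (LRen ϰ φ ε) r₀.toClass (timeBound ϰ φ α₀ α) k ∧
      ∀ k' : ℝ → K d α,
        IsClassicalSolution (LRen ϰ φ ε) r₀.toClass (timeBound ϰ φ α₀ α) k' →
        EqOn k' k (Ico 0 (timeBound ϰ φ α₀ α))) ∧
    (∃ r : ℝ → K d α,
      IsClassicalSolution (LVlasov ϰ φ) r₀.toClass (timeBound ϰ φ α₀ α) r ∧
      ∀ r' : ℝ → K d α,
        IsClassicalSolution (LVlasov ϰ φ) r₀.toClass (timeBound ϰ φ α₀ α) r' →
        EqOn r' r (Ico 0 (timeBound ϰ φ α₀ α))) ∧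
    -- and the former converge to the latter as `ε → 0`, uniformly on compact time intervals
    ∀ (k : ℝ → ℝ → K d α) (r : ℝ → K d α),
      (∀ ε : ℝ, 0 < ε →
        IsClassicalSolution (LRen ϰ φ ε) r₀.toClass (timeBound ϰ φ α₀ α) (k ε)) →
      IsClassicalSolution (LVlasov ϰ φ) r₀.toClass (timeBound ϰ φ α₀ α) r →
      ∀ T : ℝ, T < timeBound ϰ φ α₀ α →
        TendstoUniformlyOn k r (𝓝[>] 0) (Icc 0 T) := by
  -- The potential is only a.e. measurable and essentially bounded. An everywhere measurable and
  -- bounded version changes the generators only on $\lambda$-null sets and leaves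
  -- $\langle\phi\rangle$ unchanged.
  obtain ⟨ψ, D, hψ, hψ0, hψD, hφψ⟩ :=
    exists_bounded_measurable_representative hφ_nonneg hφ_Linfty
  have hψi : Integrable ψ := (memLp_one_iff_integrable.1 hφ_L1).congr hφψ
  have hD : 0 ≤ D := (hψ0 0).trans (hψD 0)
  have hT : timeBound ϰ φ α₀ α = timeBound ϰ ψ α₀ α := by
    rw [timeBound, timeBound, integral_congr_ae hφψ]
  have hV := isKernel_vlasov hψ hψ0
  have hR := fun {ε : ℝ} (hε : 0 < ε) => isKernel_rescaled hψ hψ0 hε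
  have hVop : ∀ k, LVlasov ϰ φ k =ᵐ[lebesguePoisson d]
      glauberOp ϰ (fun _ => 1) (fun x => -ψ x) k := fun k => by
    rw [LVlasov_eq_glauberOp]
    refine glauberOp_congr_kernel hd ϰ EventuallyEq.rfl ?_ k
    filter_upwards [hφψ] with x hx
    rw [hx]
  have hRop : ∀ {ε : ℝ}, 0 < ε → ∀ k, LRen ϰ φ ε k =ᵐ[lebesguePoisson d]
      glauberOp ϰ (fun x => Real.exp (-(ε * ψ x)))
        (fun x => ε⁻¹ * (Real.exp (-(ε * ψ x)) - 1)) k := fun hε k => by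
    rw [LRen_eq_glauberOp hd ϰ φ hε]
    refine glauberOp_congr_kernel hd ϰ ?_ ?_ k <;>
    · filter_upwards [hφψ] with x hx
      rw [hx]
  have hsing := fun (C G : Pt d → ℝ) (h : IsKernel ψ C G) =>
    h.isSingular hd hϰ.le hψ hψ0 hψi
  rw [hT]
  refine ⟨fun ε hε => ?_, ?_, fun k r hk hr T hTT => ?_⟩
  · simp only [(hR hε).isClassicalSolution_iff hd (hRop hε)]
    exact (hR hε).exists_unique_isSolution hd hϰ.le hψ hψ0 hψi hα r₀
  · simp only [hV.isClassicalSolution_iff hd hVop]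
    exact hV.exists_unique_isSolution hd hϰ.le hψ hψ0 hψi hα r₀
  · have hpos : ∀ᶠ ε : ℝ in 𝓝[>] 0, 0 < ε := self_mem_nhdsWithin
    refine NormedScale.tendstoUniformlyOn_of_isSolution (S := kScale d)
      (B := fun ε => glauberClass ϰ (fun x => Real.exp (-(ε * ψ x)))
        fun x => ε⁻¹ * (Real.exp (-(ε * ψ x)) - 1))
      (hsing _ _ hV α α₀) (hpos.mono fun ε hε => hsing _ _ (hR hε) α α₀) (by positivity) hα ?_
      (sub_one_lt α) (by positivity) (hsing _ _ hV (α - 1) α)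
      (hpos.mono fun ε hε => hsing _ _ (hR hε) (α - 1) α)
      ((hV.isClassicalSolution_iff hd hVop).1 hr)
      (hpos.mono fun ε hε => ((hR hε).isClassicalSolution_iff hd (hRop hε)).1 (hk ε hε)) hTT
    intro a b _ hba _ x y hy z hz
    have hδ : Tendsto (fun ε : ℝ => ε * D) (𝓝[>] 0) (𝓝 0) := by
      have : Tendsto (fun ε : ℝ => ε * D) (𝓝 0) (𝓝 (0 * D)) := tendsto_id.mul_const D
      rw [zero_mul] at this
      exact this.mono_left nhdsWithin_le_nhds
    refine tendsto_of_glauberClass hd hϰ.le hV hψ hψ0 hψi hδ ?_ hba x y hy z hz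
    filter_upwards [hpos] with ε hε
    obtain ⟨h1, h2⟩ := abs_rescaled_sub_vlasov_le hψ0 hψD hε
    exact ⟨hR hε, by positivity, h1, h2⟩
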